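/- **Setting.** Let $A=\{a_1,\dots,a_n\}$ be a set of agents and $H=\{h_1,\dots,h_n\}$ a set of houses. Every agent has a strict preference list over all houses; $\mathrm{rank}(a,h)\in\{1,\dots,n\}$ is the place of $h$ in the list of $a$. A matching is a set $M\subseteq A\times H$ in which no agent and no house appears in more than one pair; $r^M_l$ denotes the number of agents that $M$ matches to a house of rank $l$. $M$ is rank-maximal if $(r^M_1,\dots,r^M_n)$ is lexicographically maximal among all matchings. In the next-best query model, the $k$-th query to an agent $a$ returns the house that $a$ ranks $k$-th. A matching is necessarily rank-maximal (NRM) for a sequence of answered queries if it is rank-maximal for all preference profiles that give the same answers to these queries. For a preference profile $\succ$, let $\mathrm{opt}_\succ$ be the minimum number of queries, answered according to $\succ$, after which some NRM matching exists. An online algorithm, which has access to the preferences only through the answers to its queries, is $\alpha$-competitive if it asks at most $\alpha\cdot\mathrm{opt}_\succ$ queries on every profile $\succ$. For a bipartite graph with vertex set $A\cup H$ and a maximum matching $M$ of it, let $\mathcal E$ (resp. $\mathcal O$) be the set of vertices that can be reached from an $M$-unmatched vertex by an $M$-alternating path of even (resp. odd) length, and $\mathcal U$ the set of all other vertices (Dulmage–Mendelsohn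 decomposition). **Algorithm.** If $n=2$, query $a_1$, match $a_1$ to the returned house and $a_2$ to the other house. Otherwise start with $U=A$, $V=H$, $E=M=F=\emptyset$, and for $i=1,\dots,n-1$: 1. query every $a\in U$ once (in any order); if the returned house $h$ is in $V$ and $\{a,h\}\notin F$, add $\{a,h\}$ to $E$; 2. augment $M$ to a maximum matching of $(A\cup H,E)$ (so that matched vertices remain matched), and compute $\mathcal U,\mathcal E,\mathcal O$; 3. remove from $U$ and $V$ all agents and houses in $\mathcal U\cup\mathcal O$; move all edges of $E$ between $\mathcal O$ and $\mathcal O$ and between $\mathcal O$ and $\mathcal U$ from $E$ to $F$. Finally, if an agent and a house are left unmatched by $M$, add this pair to $M$; return $M$. **Algorithm of Irving et al. (with full knowledge of the preferences).** Start with $M_0=\emptyset$ and no deleted edges. For $i=1,2,\dots$: let $G_i$ consist of all edges of rank at most $i$ that have not been deleted; augment $M_{i-1}$ to a maximum matching $M_i$ of $G_i$; compute $\mathcal U_i,\mathcal E_i,\mathcal O_i$ for $G_i$; delete all edges of rank larger than $i$ that have an endpoint in $\mathcal U_i\cup\mathcal O_i$, and all edges of $G_i$ between $\mathcal O_i$ and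 $\mathcal O_i$ and between $\mathcal O_i$ and $\mathcal U_i$. **Theorem.** For every $n$, the steps of the algorithm can be carried out, and however the choices (order of the queries within a round, choice of the augmented maximum matching) are made, the following holds. - The main loop simulates the algorithm of Irving et al.: in each round $i\le n-1$, the graph $(A\cup H,E)$ after step 1 is $G_i$, and the matching computed in step 2 is $M_i$ (when both algorithms augment in the same way). - On every preference profile the algorithm returns a necessarily rank-maximal matching for the answers it received. - The algorithm is $\frac32$-competitive: on every profile $\succ$ it asks at most $\frac32\,\mathrm{opt}_\succ$ queries. In particular, there is an online algorithm with a constant competitive ratio for eliciting a necessarily rank-maximal matching in the next-best query model. -/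

import Mathlib

namespace HouseAllocation

/-! ## Instances, matchings, rank-maximality

Agents and houses are both indexed by `Fin n` (so `a_{i+1}`, `h_{i+1}` is the index `i`). -/

/-- A preference profile: `p a k` is the house that agent `a` lists at place `k + 1`;
so `p a` is a strict preference list over all houses. -/
abbrev Profile (n : ℕ) := Fin n → Equiv.Perm (Fin n)

/-- The rank of house `h` for agent `a`, a number in `{1, …, n}`. -/
def rank {n : ℕ} (p : Profile n) (a h : Fin n) : ℕ := ((p a).symm h : ℕ) + 1

/-- A set of agent–house pairs: the first component is the agent, the second the house. -/
abbrev Edges (n : ℕ) := Finset (Fin n × Fin n)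

/-- A (possibly partial) matching: no agent and no house appears in more than one pair. -/
def IsMatching {n : ℕ} (M : Edges n) : Prop :=
  ∀ e ∈ M, ∀ f ∈ M, e.1 = f.1 ∨ e.2 = f.2 → e = f

/-- `r^M_l`: the number of agents that `M` matches to a house of rank `l`. -/
noncomputable def rankCount {n : ℕ} (p : Profile n) (M : Edges n) (l : ℕ) : ℕ :=
  {a : Fin n | ∃ h, (a, h) ∈ M ∧ rank p a h = l}.ncard

/-- `M'` rank-dominates `M`. -/
def RankDominates {n : ℕ} (p : Profile n) (M' M : Edges n) : Prop :=
  ∃ l ∈ Finset.Icc 1 n,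
    (∀ k ∈ Finset.Icc 1 (l - 1), rankCount p M k = rankCount p M' k) ∧
      rankCount p M l < rankCount p M' l

/-- `M` is a rank-maximal matching. -/
def IsRankMaximal {n : ℕ} (p : Profile n) (M : Edges n) : Prop :=
  IsMatching M ∧ ∀ M', IsMatching M' → ¬ RankDominates p M' M

/-! ## The next-best query model -/

/-- A sequence of queries with their answers, in chronological order: an entry `(a, h)` says that
agent `a` was queried and answered with the house `h`. -/
abbrev History (n : ℕ) := List (Fin n × Fin n)

/-- The number of queries that have been asked to `a`. -/
def numAsked {n : ℕ} (hist : History n) (a : Fin n) : ℕ :=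
  hist.countP (fun e => e.1 = a)

/-- The answer of `a` to the next query after `hist` if the preferences are `p`: the `k`-th query
to `a` reveals the house that `a` ranks `k`-th. There is no answer once all `n` houses have been
revealed. -/
def nextBest {n : ℕ} (p : Profile n) (hist : History n) (a : Fin n) : Option (Fin n) :=
  if hk : numAsked hist a < n then some (p a ⟨numAsked hist a, hk⟩) else none

/-- The profile `p` gives exactly the recorded answers to the recorded queries. -/
def Consistent {n : ℕ} (p : Profile n) (hist : History n) : Prop :=
  ∀ (l₁ l₂ : History n) (a h : Fin n), hist = l₁ ++ (a, h) :: l₂ → nextBest p l₁ a = some h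

/-- `M` is a necessarily rank-maximal matching for the elicited answers `hist`. -/
def IsNecessarilyRankMaximal {n : ℕ} (hist : History n) (M : Edges n) : Prop :=
  ∀ p : Profile n, Consistent p hist → IsRankMaximal p M

/-- The number of queries of an optimal algorithm that knows `p`: the minimum length of a sequence
of queries (answered according to `p`) for which a necessarily rank-maximal matching exists. -/
noncomputable def opt {n : ℕ} (p : Profile n) : ℕ :=
  sInf {q | ∃ hist : History n, hist.length = q ∧ Consistent p hist ∧
    ∃ M, IsNecessarilyRankMaximal hist M}

/-- Online algorithms in the next-best query model: an algorithm either stops with a result, or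
queries an agent and continues depending on the house it gets as the answer. It has no other
access to the preferences. -/
inductive Online (n : ℕ) (α : Type) : Type
  | ret (x : α) : Online n α
  | query (a : Fin n) (next : Fin n → Online n α) : Online n α

namespace Online

/-- Sequential composition. -/
def bind {n : ℕ} {α β : Type} : Online n α → (α → Online n β) → Online n β
  | ret x, f => f x
  | query a next, f => query a (fun h => bind (next h) f)

/-- Run the algorithm on agents with preferences `p`, after the queries `hist` were asked. The
result consists of the output and the history of all queries. It is `none` if some agent is
queried more than `n` times. -/
def run {n : ℕ} {α : Type} (p : Profile n) : Online n α → History n → Option (α × History n)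
  | ret x, hist => some (x, hist)
  | query a next, hist =>
    match nextBest p hist a with
    | some h => run p (next h) (hist ++ [(a, h)])
    | none => none

end Online

/-- On every preference profile the algorithm stops with a matching that is necessarily
rank-maximal for the answers that it got. -/
def ElicitsNRM {n : ℕ} (alg : Online n (Edges n)) : Prop :=
  ∀ p : Profile n, ∃ M hist, alg.run p [] = some (M, hist) ∧ IsNecessarilyRankMaximal hist M

/-- On every preference profile `p` the algorithm asks at most `α * opt p` queries. -/
def IsCompetitive {n : ℕ} (α : ℝ) (alg : Online n (Edges n)) : Prop :=
  ∀ p : Profile n, ∃ M hist, alg.run p [] = some (M, hist) ∧ (hist.length : ℝ) ≤ α * (opt p : ℝ)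

/-! ## Maximum matchings and the Dulmage–Mendelsohn decomposition

A vertex of the bipartite graph is `Sum.inl a` for an agent and `Sum.inr h` for a house. -/

/-- `M` is a maximum matching in the graph with edge set `E`. -/
def IsMaximumMatching {n : ℕ} (E M : Edges n) : Prop :=
  M ⊆ E ∧ IsMatching M ∧ ∀ M', M' ⊆ E → IsMatching M' → M'.card ≤ M.card

/-- The vertex `v` is an endpoint of an edge of `M`. -/
def Covered {n : ℕ} (M : Edges n) : Fin n ⊕ Fin n → Prop
  | Sum.inl a => ∃ h, (a, h) ∈ M
  | Sum.inr h => ∃ a, (a, h) ∈ M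

/-- `v` and `w` are the two endpoints of an edge in `E`. -/
def Joined {n : ℕ} (E : Edges n) : Fin n ⊕ Fin n → Fin n ⊕ Fin n → Prop
  | Sum.inl a, Sum.inr h => (a, h) ∈ E
  | Sum.inr h, Sum.inl a => (a, h) ∈ E
  | _, _ => False

/-- `AltReach E M odd v`: there is an alternating path between an unmatched vertex and `v` whose
length is odd if `odd = true` and even if `odd = false`. Starting from the unmatched vertex, the
path uses alternately edges outside `M` and in `M`. (A walk of this form in a bipartite graph can
be shortened to a path of the same parity.) -/
inductive AltReach {n : ℕ} (E M : Edges n) : Bool → Fin n ⊕ Fin n → Prop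
  | start (v : Fin n ⊕ Fin n) (hv : ¬ Covered M v) : AltReach E M false v
  | unmatchedStep (v w : Fin n ⊕ Fin n) (hv : AltReach E M false v) (hw : Joined (E \ M) v w) :
      AltReach E M true w
  | matchedStep (v w : Fin n ⊕ Fin n) (hv : AltReach E M true v) (hw : Joined M v w) :
      AltReach E M false w

/-- The part `𝓔` of the Dulmage–Mendelsohn decomposition. -/
def InE {n : ℕ} (E M : Edges n) (v : Fin n ⊕ Fin n) : Prop := AltReach E M false v

/-- The part `𝓞` of the Dulmage–Mendelsohn decomposition. -/
def InO {n : ℕ} (E M : Edges n) (v : Fin n ⊕ Fin n) : Prop := AltReach E M true v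

/-- The part `𝓤` of the Dulmage–Mendelsohn decomposition. -/
def InU {n : ℕ} (E M : Edges n) (v : Fin n ⊕ Fin n) : Prop := ¬ InE E M v ∧ ¬ InO E M v

/-- The edges of `E` that connect two vertices in `𝓞`, or a vertex in `𝓞` and a vertex in `𝓤`. -/
noncomputable def forbiddenEdges {n : ℕ} (E M : Edges n) : Edges n := by
  classical exact E.filter (fun e =>
    (InO E M (Sum.inl e.1) ∧ InO E M (Sum.inr e.2)) ∨
    (InO E M (Sum.inl e.1) ∧ InU E M (Sum.inr e.2)) ∨
    (InU E M (Sum.inl e.1) ∧ InO E M (Sum.inr e.2)))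

/-- The choices that the two algorithms below leave open, for every round `i`: in which order the
agents of a set are queried, and to which maximum matching `M` is augmented. A maximum matching
arises from `M` by augmentation only if it still covers all vertices that `M` covers. -/
structure Choices (n : ℕ) where
  order : ℕ → Finset (Fin n) → List (Fin n)
  order_nodup : ∀ i U, (order i U).Nodup
  mem_order : ∀ i U a, a ∈ order i U ↔ a ∈ U
  augment : ℕ → Edges n → Edges n → Edges n
  augment_maximum : ∀ i E M, M ⊆ E → IsMatching M → IsMaximumMatching E (augment i E M)
  augment_covered : ∀ i E M, M ⊆ E → IsMatching M →
    ∀ v, Covered M v → Covered (augment i E M) v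

/-! ## The elicitation algorithm -/

/-- The variables of the algorithm: unfinished agents `U`, available houses `V`, edges `E`, the
matching `M`, and forbidden edges `F`. -/
structure State (n : ℕ) where
  U : Finset (Fin n)
  V : Finset (Fin n)
  E : Edges n
  M : Edges n
  F : Edges n

/-- `U ← A`, `V ← H`, `E ← ∅`, `M ← ∅`, `F ← ∅`. -/
def State.init (n : ℕ) : State n := ⟨Finset.univ, Finset.univ, ∅, ∅, ∅⟩

/-- Query the listed agents one after the other. The edge between an agent and the house that it
reveals is added to `E` if the house is still available and the edge is not forbidden. -/
def elicitList {n : ℕ} : List (Fin n) → State n → Online n (State n)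
  | [], s => Online.ret s
  | a :: as, s => Online.query a (fun h =>
      elicitList as (if h ∈ s.V ∧ (a, h) ∉ s.F then { s with E := insert (a, h) s.E } else s))

/-- The queries of round `i`: query each unfinished agent once. -/
def elicit {n : ℕ} (c : Choices n) (i : ℕ) (s : State n) : Online n (State n) :=
  elicitList (c.order i s.U) s

/-- The rest of round `i`: augment `M` to a maximum matching, compute the Dulmage–Mendelsohn
decomposition, remove the agents and houses in `𝓤` and `𝓞` from `U` and `V`, and move the
`𝓞𝓞`- and `𝓞𝓤`-edges from `E` to `F`. -/
noncomputable def update {n : ℕ} (c : Choices n) (i : ℕ) (s : State n) : State n := by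
  classical exact
    let M := c.augment i s.E s.M
    { U := s.U.filter (fun a => ¬ (InU s.E M (Sum.inl a) ∨ InO s.E M (Sum.inl a)))
      V := s.V.filter (fun h => ¬ (InU s.E M (Sum.inr h) ∨ InO s.E M (Sum.inr h)))
      E := s.E \ forbiddenEdges s.E M
      M := M
      F := s.F ∪ forbiddenEdges s.E M }

/-- The rounds `1, …, m` of the main loop. -/
noncomputable def rounds {n : ℕ} (c : Choices n) : ℕ → Online n (State n)
  | 0 => Online.ret (State.init n)
  | m + 1 => (rounds c m).bind (fun s =>
      (elicit c (m + 1) s).bind (fun s' => Online.ret (update c (m + 1) s')))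

/-- Add to `M` the pair of the agent and the house that `M` leaves unmatched (if there is one). -/
noncomputable def complete {n : ℕ} (M : Edges n) : Edges n := by
  classical exact
    M ∪ Finset.univ.filter (fun e => ¬ Covered M (Sum.inl e.1) ∧ ¬ Covered M (Sum.inr e.2))

/-- The elicitation algorithm. For two agents, `a₁` is queried and gets its answer, and `a₂` gets
the other house. Otherwise the main loop makes `n - 1` rounds. -/
noncomputable def elicitationAlgorithm : (n : ℕ) → Choices n → Online n (Edges n)
  | 2, _ => Online.query 0 (fun h => Online.ret {(0, h), (1, Equiv.swap 0 1 h)})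
  | n, c => (rounds c (n - 1)).bind (fun s => Online.ret (complete s.M))

/-! ## The rank-maximal matching algorithm of Irving et al. (with full preferences) -/

/-- The graph of round `i` if the edges in `D` have been deleted before: all edges of rank `i` or
less that are not in `D`. -/
def rankGraph {n : ℕ} (p : Profile n) (i : ℕ) (D : Edges n) : Edges n :=
  Finset.univ.filter (fun e => rank p e.1 e.2 ≤ i ∧ e ∉ D)

/-- The deleted edges and the matching `M_i` after round `i`. In round `i` the algorithm takes the
edges of rank at most `i` that are not deleted, augments `M_{i-1}` to a maximum matching `M_i`, and
deletes all edges of rank larger than `i` that have an endpoint in `𝓤` or `𝓞`, as well as all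
`𝓞𝓞`- and `𝓞𝓤`-edges. -/
noncomputable def irving {n : ℕ} (c : Choices n) (p : Profile n) : ℕ → Edges n × Edges n
  | 0 => (∅, ∅)
  | i + 1 => by
    classical exact
      let D := (irving c p i).1
      let E := rankGraph p (i + 1) D
      let M := c.augment (i + 1) E (irving c p i).2
      (D ∪ Finset.univ.filter (fun e => i + 1 < rank p e.1 e.2 ∧
          (InU E M (Sum.inl e.1) ∨ InO E M (Sum.inl e.1) ∨
            InU E M (Sum.inr e.2) ∨ InO E M (Sum.inr e.2))) ∪
        forbiddenEdges E M, M)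

/-- The graph `G_i` of round `i ≥ 1` in the algorithm of Irving et al. -/
noncomputable def irvingGraph {n : ℕ} (c : Choices n) (p : Profile n) (i : ℕ) : Edges n :=
  rankGraph p i (irving c p (i - 1)).1

/-- The matching `M_i` after round `i` in the algorithm of Irving et al. -/
noncomputable def irvingMatching {n : ℕ} (c : Choices n) (p : Profile n) (i : ℕ) : Edges n :=
  (irving c p i).2

/-- The main loop simulates the algorithm of Irving et al.: in each of its `n - 1` rounds, the
graph after the queries is `G_i`, and the matching computed in that round is `M_i`. -/
def SimulatesIrving {n : ℕ} (c : Choices n) : Prop :=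
  ∀ (p : Profile n) (i : ℕ), i < n - 1 → ∃ s hist,
    ((rounds c i).bind (elicit c (i + 1))).run p [] = some (s, hist) ∧
      s.E = irvingGraph c p (i + 1) ∧ (update c (i + 1) s).M = irvingMatching c p (i + 1)

end HouseAllocation

/-!
The elicitation algorithm asks exactly the questions that the algorithm of Irving et al. needs:
an edge of rank `i + 1` enters the graph of round `i + 1` if and only if both of its endpoints have
been in the part `𝓔` of the Dulmage–Mendelsohn decomposition in all rounds up to `i` (`Alive`), and
such endpoints are the unfinished agents and available houses (`exists_run_rounds`).

**Decomposition.** The agents outside `𝓔` and the houses in `𝓞` form a vertex cover that has as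
many vertices as a matching without augmenting walk has edges. Complementary slackness shows that
every maximum matching covers all vertices outside `𝓔`, that it joins `𝓞` to `𝓔`, and that the
decomposition does not depend on the maximum matching (`IsMaximumMatching.altReach_iff`).

**Rank-maximality.** A matching is rank-maximal if and only if for every `j`, its pairs of rank at
most `j` form a maximum matching of the graph of round `j` (`isRankMaximal_iff_good`). After
`n - 1` rounds, a pair that is left over has rank `n`, so it can be added to the matching. The
result is rank-maximal on every profile, and necessarily so because the run depends on the answers
only.

**Competitive ratio.** Let `M` be necessarily rank-maximal after `k a` queries to every agent `a`,
and let `t a` be the number of queries of the elicitation algorithm to `a`. Changing the part of a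
profile that is not known gives lower bounds on `k`, as `M` has to meet the above criterion for the
changed profile, too.
* If the rank of `M a` is known, then `t a - 1 ≤ k a` (`le_numAsked_of_alive`).
* If it is not known for some `a`, then `t b ≤ k b` for all `b ≠ a` (`le_numAsked_of_unknown`).
  The profile that shows this makes `M a` the last house of `a` and the next house of `b`. Either
  this permits an augmentation, or the walk that leads from an uncovered agent to `b`, reversed,
  is an alternating walk from `M a` to a house that `a` prefers, which permits one later on.
* An agent `a` stays in `𝓔` only together with the agent that gets the first choice of `a`
  (`Alive.of_same_first`).

For `n ≥ 3`, the ratio follows by counting. If all ranks are known, there is a loss only at agents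
with `t a = 2` and `k a = 1`; each of these is paired with an agent of the same first choice with
`t b = 2 ≤ k b`. If the rank of `M a` is unknown, the loss at `a` is compensated by the other
agents. If `k a = 0` for some `a`, then `k b ≥ n - 1` for all others.
-/

namespace HouseAllocation

/-! ### Alternating walks -/

section Walks

variable {n : ℕ} {E M N : Edges n}

/-- `RootReach E M r odd v`: there is an alternating walk from `r` to `v`, starting with an edge
outside `M`, whose length has the parity `odd`. In contrast to `AltReach`, the starting vertex is
fixed and may be covered by `M`. -/
inductive RootReach (E M : Edges n) (r : Fin n ⊕ Fin n) : Bool → Fin n ⊕ Fin n → Prop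
  | start : RootReach E M r false r
  | unmatchedStep {v w : Fin n ⊕ Fin n} (hv : RootReach E M r false v)
      (hw : Joined (E \ M) v w) : RootReach E M r true w
  | matchedStep {v w : Fin n ⊕ Fin n} (hv : RootReach E M r true v) (hw : Joined M v w) :
      RootReach E M r false w

theorem altReach_iff_rootReach {b : Bool} {v : Fin n ⊕ Fin n} :
    AltReach E M b v ↔ ∃ r, ¬ Covered M r ∧ RootReach E M r b v := by
  constructor
  · intro h
    induction h with
    | start v hv => exact ⟨v, hv, .start⟩
    | unmatchedStep v w _ hw ih =>
      obtain ⟨r, hr, h⟩ := ih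
      exact ⟨r, hr, h.unmatchedStep hw⟩
    | matchedStep v w _ hw ih =>
      obtain ⟨r, hr, h⟩ := ih
      exact ⟨r, hr, h.matchedStep hw⟩
  · rintro ⟨r, hr, h⟩
    induction h with
    | start => exact .start r hr
    | unmatchedStep _ hw ih => exact .unmatchedStep _ _ ih hw
    | matchedStep _ hw ih => exact .matchedStep _ _ ih hw

theorem Joined.symm {v w : Fin n ⊕ Fin n} (h : Joined E v w) : Joined E w v := by
  rcases v with a | x <;> rcases w with b | y <;> exact h

theorem Joined.mono {v w : Fin n ⊕ Fin n} (hEN : E ⊆ N) (h : Joined E v w) : Joined N v w := by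
  rcases v with a | x <;> rcases w with b | y <;> simp_all [Joined] <;> exact hEN h

theorem Joined.isLeft {v w : Fin n ⊕ Fin n} (h : Joined E v w) : w.isLeft = !v.isLeft := by
  rcases v with a | x <;> rcases w with b | y <;> simp_all [Joined]

theorem Joined.covered {v w : Fin n ⊕ Fin n} (h : Joined M v w) : Covered M v := by
  rcases v with a | x <;> rcases w with b | y <;> simp_all [Joined, Covered] <;> exact ⟨_, h⟩

theorem Covered.exists_joined {v : Fin n ⊕ Fin n} (h : Covered M v) : ∃ w, Joined M v w := by
  rcases v with a | x
  · obtain ⟨y, hy⟩ := h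
    exact ⟨.inr y, hy⟩
  · obtain ⟨a, ha⟩ := h
    exact ⟨.inl a, ha⟩

theorem Covered.mono {v : Fin n ⊕ Fin n} (hMN : M ⊆ N) (h : Covered M v) : Covered N v := by
  obtain ⟨w, hw⟩ := h.exists_joined
  exact (hw.mono hMN).covered

theorem IsMatching.joined_unique {v w w' : Fin n ⊕ Fin n} (hM : IsMatching M)
    (h : Joined M v w) (h' : Joined M v w') : w = w' := by
  rcases v with a | x <;> rcases w with b | y <;> rcases w' with b' | y' <;>
    simp_all only [Joined]
  · have := hM _ h _ h' (Or.inl rfl); simp_all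
  · have := hM _ h _ h' (Or.inr rfl); simp_all

theorem IsMatching.house_unique {a x y : Fin n} (hM : IsMatching M) (h : (a, x) ∈ M)
    (h' : (a, y) ∈ M) : x = y :=
  congrArg Prod.snd (hM _ h _ h' (Or.inl rfl))

theorem IsMatching.agent_unique {a b x : Fin n} (hM : IsMatching M) (h : (a, x) ∈ M)
    (h' : (b, x) ∈ M) : a = b :=
  congrArg Prod.fst (hM _ h _ h' (Or.inr rfl))

theorem IsMatching.subset (hM : IsMatching M) (h : N ⊆ M) : IsMatching N :=
  fun e he f hf => hM e (h he) f (h hf)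

theorem isMatching_empty : IsMatching (∅ : Edges n) := by
  intro e he
  simp at he

/-- An alternating walk changes the side of the graph exactly if its length is odd. -/
theorem RootReach.isLeft {r v : Fin n ⊕ Fin n} {b : Bool} (h : RootReach E M r b v) :
    v.isLeft = (r.isLeft ^^ b) := by
  induction h with
  | start => simp
  | unmatchedStep _ hw ih => rw [hw.isLeft, ih]; simp
  | matchedStep _ hw ih => rw [hw.isLeft, ih]; simp

/-- An alternating walk from `r` to `v`, reversed, continues an alternating walk from `s` to `v`
of the other parity. -/
theorem RootReach.reverse {r s v : Fin n ⊕ Fin n} {b : Bool} (h : RootReach E M r b v)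
    (hs : RootReach E M s (!b) v) : RootReach E M s true r := by
  induction h with
  | start => exact hs
  | unmatchedStep _ hw ih => exact ih (hs.unmatchedStep hw.symm)
  | matchedStep _ hw ih => exact ih (hs.matchedStep hw.symm)

/-! ### Augmentation -/

/-- Augmentation along an alternating walk, which is given by its agents `f 0, …, f k` and its
last house `h`. -/
theorem exists_augmentation_of_walk (E : Edges n) (k : ℕ) : ∀ (M : Edges n) (f : ℕ → Fin n)
    (h : Fin n), M ⊆ E → IsMatching M → ¬ Covered M (.inl (f 0)) →
    (∀ j < k, ∃ x, (f j, x) ∈ E ∧ (f (j + 1), x) ∈ M) → (f k, h) ∈ E → ¬ Covered M (.inr h) →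
    ∃ N ⊆ E, IsMatching N ∧ M.card < N.card ∧ (∀ v, Covered M v → Covered N v) ∧
      Covered N (.inl (f 0)) := by
  induction k using Nat.strong_induction_on with
  | _ k ih =>
  intro M f h hME hM h0 hstep hlast hh
  rcases Nat.eq_zero_or_pos k with rfl | hk
  · refine ⟨insert (f 0, h) M, ?_, ?_, ?_, fun v hv => hv.mono (Finset.subset_insert _ _),
      ⟨h, Finset.mem_insert_self _ _⟩⟩
    · exact Finset.insert_subset hlast hME
    · intro e he g hg heg
      rw [Finset.mem_insert] at he hg
      rcases he with rfl | he <;> rcases hg with rfl | hg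
      · rfl
      · rcases heg with heg | heg
        · exact absurd ⟨g.2, by rw [show f 0 = g.1 from heg]; exact hg⟩ h0
        · exact absurd ⟨g.1, by rw [show h = g.2 from heg]; exact hg⟩ hh
      · rcases heg with heg | heg
        · exact absurd ⟨e.2, by rw [show f 0 = e.1 from heg.symm]; exact he⟩ h0
        · exact absurd ⟨e.1, by rw [show h = e.2 from heg.symm]; exact he⟩ hh
      · exact hM e he g hg heg
    · rw [Finset.card_insert_of_notMem (fun hmem => h0 ⟨h, hmem⟩)]
      exact Nat.lt_succ_self _
  by_cases hrep : ∃ j, 2 ≤ j ∧ j ≤ k ∧ f j = f 1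
  · -- The walk returns to `f 1`: leave out the closed part.
    obtain ⟨j, hj2, hjk, hj⟩ := hrep
    refine ih (k + 1 - j) (by omega) M (fun m => if m = 0 then f 0 else f (m + j - 1)) h hME hM
      (by simpa using h0) ?_ ?_ hh
    · intro m hm
      rcases Nat.eq_zero_or_pos m with rfl | hm0
      · have := hstep 0 (by omega)
        simp only [if_true, zero_add, Nat.one_ne_zero, if_false]
        rw [show 1 + j - 1 = j by omega, hj]
        exact this
      · have := hstep (m + j - 1) (by omega)
        rw [if_neg (by omega), if_neg (by omega), show m + 1 + j - 1 = m + j - 1 + 1 by omega]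
        exact this
    · rw [if_neg (by omega), show k + 1 - j + j - 1 = k by omega]
      exact hlast
  push Not at hrep
  -- Switch the first two edges of the walk; the rest is an alternating walk from `f 1`.
  obtain ⟨x, hx0, hx1⟩ := hstep 0 hk
  rw [zero_add] at hx1
  have h01 : f 0 ≠ f 1 := fun heq => h0 ⟨x, heq ▸ hx1⟩
  have hxh : x ≠ h := fun heq => hh ⟨f 1, heq ▸ hx1⟩
  set M' := insert (f 0, x) (M.erase (f 1, x)) with hM'
  have hmem : ∀ e, e ∈ M' ↔ e = (f 0, x) ∨ (e ≠ (f 1, x) ∧ e ∈ M) := by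
    intro e; rw [hM', Finset.mem_insert, Finset.mem_erase]
  have hcard : M'.card = M.card := by
    rw [hM', Finset.card_insert_of_notMem, Finset.card_erase_of_mem hx1]
    · have := Finset.card_pos.2 ⟨_, hx1⟩
      omega
    · exact fun hm => h0 ⟨x, Finset.mem_of_mem_erase hm⟩
  have hcov : ∀ v, Covered M v → v ≠ .inl (f 1) → Covered M' v := by
    rintro (a | y) hv hne
    · obtain ⟨y, hy⟩ := hv
      refine ⟨y, (hmem _).2 (Or.inr ⟨fun heq => hne ?_, hy⟩)⟩
      rw [(Prod.mk.inj heq).1]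
    · obtain ⟨a, ha⟩ := hv
      by_cases hxy : y = x
      · exact ⟨f 0, (hmem _).2 (Or.inl (by rw [hxy]))⟩
      · exact ⟨a, (hmem _).2 (Or.inr ⟨fun heq => hxy (Prod.mk.inj heq).2, ha⟩)⟩
  have hM'E : M' ⊆ E := by
    intro e he
    rcases (hmem e).1 he with rfl | he
    · exact hx0
    · exact hME he.2
  have hM'm : IsMatching M' := by
    intro e he g hg heg
    rcases (hmem e).1 he with rfl | ⟨he1, he⟩ <;> rcases (hmem g).1 hg with rfl | ⟨hg1, hg⟩
    · rfl
    · rcases heg with heg | heg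
      · exact absurd ⟨g.2, by rw [show f 0 = g.1 from heg]; exact hg⟩ h0
      · exact absurd (hM _ hg _ hx1 (Or.inr heg.symm)) hg1
    · rcases heg with heg | heg
      · exact absurd ⟨e.2, by rw [show f 0 = e.1 from heg.symm]; exact he⟩ h0
      · exact absurd (hM _ he _ hx1 (Or.inr heg)) he1
    · exact hM e he g hg heg
  have hM'0 : ¬ Covered M' (.inl (f 1)) := by
    rintro ⟨y, hy⟩
    rcases (hmem _).1 hy with heq | ⟨hne, hy⟩
    · exact h01 (Prod.mk.inj heq).1.symm
    · exact hne (by rw [hM.house_unique hy hx1])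
  have hM'h : ¬ Covered M' (.inr h) := by
    rintro ⟨a, ha⟩
    rcases (hmem _).1 ha with heq | ⟨hne, ha⟩
    · exact hxh (Prod.mk.inj heq).2.symm
    · exact hh ⟨a, ha⟩
  obtain ⟨N, hNE, hN, hlt, hNcov, hN1⟩ := ih (k - 1) (by omega) M' (fun m => f (m + 1)) h hM'E
    hM'm hM'0 (fun j hj => by
      obtain ⟨y, hy1, hy2⟩ := hstep (j + 1) (by omega)
      exact ⟨y, hy1, (hmem _).2 (Or.inr ⟨fun heq =>
        hrep (j + 1 + 1) (by omega) (by omega) (Prod.mk.inj heq).1, hy2⟩)⟩)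
    (by rw [show k - 1 + 1 = k by omega]; exact hlast) hM'h
  refine ⟨N, hNE, hN, hcard ▸ hlt, fun v hv => ?_, hNcov _ ⟨x, (hmem _).2 (Or.inl rfl)⟩⟩
  by_cases hv1 : v = .inl (f 1)
  · rw [hv1]; exact hN1
  · exact hNcov v (hcov v hv hv1)

/-- The sequence of the agents on an alternating walk that starts at the agent `a`, both for a walk
that ends at an agent and for one that ends at a house. -/
theorem RootReach.exists_agents {a : Fin n} {b : Bool} {v : Fin n ⊕ Fin n}
    (h : RootReach E M (.inl a) b v) :
    (∀ c, v = .inl c → ∃ (k : ℕ) (f : ℕ → Fin n), f 0 = a ∧ f k = c ∧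
      ∀ j < k, ∃ x, (f j, x) ∈ E ∧ (f (j + 1), x) ∈ M) ∧
    (∀ y, v = .inr y → ∃ (k : ℕ) (f : ℕ → Fin n), f 0 = a ∧ (f k, y) ∈ E ∧
      ∀ j < k, ∃ x, (f j, x) ∈ E ∧ (f (j + 1), x) ∈ M) := by
  induction h with
  | start =>
    refine ⟨fun c hc => ⟨0, fun _ => a, rfl, Sum.inl.inj hc, by simp⟩, fun y hy => by simp at hy⟩
  | @unmatchedStep v w hv hw ih =>
    have hl := hv.isLeft
    rcases v with c | x
    · rcases w with d | y
      · exact hw.elim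
      · refine ⟨fun c hc => by simp at hc, fun z hz => ?_⟩
        obtain ⟨k, f, h0, hk, hf⟩ := ih.1 c rfl
        refine ⟨k, f, h0, ?_, hf⟩
        rw [hk, ← Sum.inr.inj hz]
        exact (Finset.mem_sdiff.1 hw).1
    · simp at hl
  | @matchedStep v w hv hw ih =>
    have hl := hv.isLeft
    rcases v with c | x
    · simp at hl
    · rcases w with d | y
      · refine ⟨fun c hc => ?_, fun z hz => by simp at hz⟩
        obtain ⟨k, f, h0, hk, hf⟩ := ih.2 x rfl
        refine ⟨k + 1, fun m => if m ≤ k then f m else c, by simpa using h0, by simp, ?_⟩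
        intro j hj
        rcases Nat.lt_or_ge j k with hjk | hjk
        · simpa [hjk.le, Nat.succ_le_iff.2 hjk] using hf j hjk
        · obtain rfl : j = k := by omega
          refine ⟨x, by simpa using hk, ?_⟩
          simpa [← Sum.inl.inj hc, Joined] using hw
      · exact hw.elim

/-- An alternating walk of odd length between two uncovered vertices yields a larger matching
that covers all vertices covered before. -/
theorem RootReach.exists_augmentation {r s : Fin n ⊕ Fin n} (h : RootReach E M r true s)
    (hME : M ⊆ E) (hM : IsMatching M) (hr : ¬ Covered M r) (hs : ¬ Covered M s) :
    ∃ N ⊆ E, IsMatching N ∧ M.card < N.card ∧ ∀ v, Covered M v → Covered N v := by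
  wlog hl : r.isLeft = true generalizing r s
  · refine this (h.reverse .start) hs hr ?_
    rw [h.isLeft]
    simpa using hl
  rcases r with a | x
  · have hsl := h.isLeft
    rcases s with b | y
    · simp at hsl
    · obtain ⟨k, f, rfl, hk, hf⟩ := h.exists_agents.2 y rfl
      obtain ⟨N, hNE, hN, hlt, hcov, -⟩ :=
        exists_augmentation_of_walk E k M f y hME hM hr hf hk hs
      exact ⟨N, hNE, hN, hlt, hcov⟩
  · simp at hl

theorem IsMaximumMatching.not_rootReach {r s : Fin n ⊕ Fin n} (hM : IsMaximumMatching E M)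
    (hr : ¬ Covered M r) (hs : ¬ Covered M s) : ¬ RootReach E M r true s := by
  intro h
  obtain ⟨N, hNE, hN, hlt, -⟩ := h.exists_augmentation hM.1 hM.2.1 hr hs
  exact absurd (hM.2.2 N hNE hN) (by omega)

theorem IsMaximumMatching.not_inO_of_inE {v : Fin n ⊕ Fin n} (hM : IsMaximumMatching E M)
    (h : InE E M v) : ¬ InO E M v := by
  intro h'
  obtain ⟨r, hr, hrv⟩ := altReach_iff_rootReach.1 h
  obtain ⟨s, hs, hsv⟩ := altReach_iff_rootReach.1 h'
  exact hM.not_rootReach hs hr (hrv.reverse hsv)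

end Walks

/-! ### The Dulmage–Mendelsohn decomposition -/

section DulmageMendelsohn

variable {n : ℕ} {E M N : Edges n}

theorem InE.inO_of_joined {v w : Fin n ⊕ Fin n} (hM : IsMatching M) (hv : InE E M v)
    (hvw : Joined E v w) : InO E M w := by
  by_cases hvM : Joined M v w
  · rcases hv with ⟨_, hc⟩ | _ | ⟨u, _, hu, huv⟩
    · exact absurd hvM.covered hc
    · rw [hM.joined_unique hvM huv.symm]
      exact hu
  · refine .unmatchedStep v w hv ?_
    rcases v with a | x <;> rcases w with b | y <;> simp_all [Joined]

theorem InO.inE_of_joined {v w : Fin n ⊕ Fin n} (hv : InO E M v) (hvw : Joined M v w) :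
    InE E M w :=
  .matchedStep v w hv hvw

theorem inE_of_not_covered {v : Fin n ⊕ Fin n} (hv : ¬ Covered M v) : InE E M v :=
  .start v hv

open Classical in
/-- The size of the vertex cover that consists of the agents outside `𝓔` and the houses in `𝓞`. -/
noncomputable def coverSize (E M : Edges n) : ℕ :=
  {a : Fin n | ¬ InE E M (.inl a)}.toFinset.card + {h : Fin n | InO E M (.inr h)}.toFinset.card

open Classical in
/-- The agents outside `𝓔` and the houses in `𝓞` cover all edges; a matching with as many edges
covers each of these vertices, and by different edges. -/
theorem card_le_coverSize (hM : IsMatching M) (hN : IsMatching N) (hNE : N ⊆ E) :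
    N.card ≤ coverSize E M ∧ (coverSize E M ≤ N.card →
      (∀ a, ¬ InE E M (.inl a) → Covered N (.inl a)) ∧
      ∀ h, InO E M (.inr h) → ∃ a, InE E M (.inl a) ∧ (a, h) ∈ N) := by
  set A := {a : Fin n | ¬ InE E M (.inl a)}.toFinset with hA
  set H := {h : Fin n | InO E M (.inr h)}.toFinset with hH
  set N₁ := N.filter (fun e => ¬ InE E M (.inl e.1)) with hN₁
  set N₂ := N.filter (fun e => InE E M (.inl e.1)) with hN₂
  have hcard : N₂.card + N₁.card = N.card := Finset.card_filter_add_card_filter_not _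
  have h1 : (N₁.image Prod.fst).card = N₁.card := Finset.card_image_of_injOn (fun e he f hf hef =>
    hN e (Finset.mem_filter.1 he).1 f (Finset.mem_filter.1 hf).1 (Or.inl hef))
  have h2 : (N₂.image Prod.snd).card = N₂.card := Finset.card_image_of_injOn (fun e he f hf hef =>
    hN e (Finset.mem_filter.1 he).1 f (Finset.mem_filter.1 hf).1 (Or.inr hef))
  have hs1 : N₁.image Prod.fst ⊆ A := by
    intro a ha
    obtain ⟨e, he, rfl⟩ := Finset.mem_image.1 ha
    simpa [hA] using (Finset.mem_filter.1 he).2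
  have hs2 : N₂.image Prod.snd ⊆ H := by
    intro h hh
    obtain ⟨e, he, rfl⟩ := Finset.mem_image.1 hh
    rw [Finset.mem_filter] at he
    have := he.2.inO_of_joined hM (w := .inr e.2) (hNE he.1)
    simpa [hH] using this
  have hc1 := Finset.card_le_card hs1
  have hc2 := Finset.card_le_card hs2
  have hcs : coverSize E M = A.card + H.card := rfl
  refine ⟨by omega, fun hle => ?_⟩
  have he1 := Finset.eq_of_subset_of_card_le hs1 (by omega)
  have he2 := Finset.eq_of_subset_of_card_le hs2 (by omega)
  constructor
  · intro a ha
    have : a ∈ N₁.image Prod.fst := by rw [he1]; simpa [hA] using ha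
    obtain ⟨e, he, rfl⟩ := Finset.mem_image.1 this
    exact ⟨e.2, (Finset.mem_filter.1 he).1⟩
  · intro h hh
    have : h ∈ N₂.image Prod.snd := by rw [he2]; simpa [hH] using hh
    obtain ⟨e, he, rfl⟩ := Finset.mem_image.1 this
    exact ⟨e.1, (Finset.mem_filter.1 he).2, (Finset.mem_filter.1 he).1⟩

open Classical in
theorem coverSize_le_card (h1 : ∀ a, ¬ InE E M (.inl a) → Covered N (.inl a))
    (h2 : ∀ h, InO E M (.inr h) → ∃ a, InE E M (.inl a) ∧ (a, h) ∈ N) :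
    coverSize E M ≤ N.card := by
  have hcard := Finset.card_filter_add_card_filter_not (s := N) (fun e => InE E M (.inl e.1))
  have hA : {a : Fin n | ¬ InE E M (.inl a)}.toFinset ⊆
      (N.filter (fun e => ¬ InE E M (.inl e.1))).image Prod.fst := by
    intro a ha
    have ha' : ¬ InE E M (.inl a) := by simpa using ha
    obtain ⟨h, hh⟩ := h1 a ha'
    exact Finset.mem_image.2 ⟨(a, h), Finset.mem_filter.2 ⟨hh, ha'⟩, rfl⟩
  have hH : {h : Fin n | InO E M (.inr h)}.toFinset ⊆
      (N.filter (fun e => InE E M (.inl e.1))).image Prod.snd := by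
    intro h hh
    obtain ⟨a, ha, hmem⟩ := h2 h (by simpa using hh)
    exact Finset.mem_image.2 ⟨(a, h), Finset.mem_filter.2 ⟨hmem, ha⟩, rfl⟩
  have := (Finset.card_le_card hA).trans Finset.card_image_le
  have := (Finset.card_le_card hH).trans Finset.card_image_le
  unfold coverSize
  omega

/-- If no vertex is in both `𝓔` and `𝓞`, then `M` has as many edges as the vertex cover. -/
theorem coverSize_le_of_disjoint (hdis : ∀ v, InE E M v → ¬ InO E M v) :
    coverSize E M ≤ M.card := by
  refine coverSize_le_card (fun a ha => not_not.1 (fun hc => ha (inE_of_not_covered hc))) ?_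
  intro h hh
  have hc : Covered M (.inr h) := not_not.1 (fun hc => hdis _ (inE_of_not_covered hc) hh)
  obtain ⟨a, ha⟩ := hc
  exact ⟨a, hh.inE_of_joined (w := .inl a) ha, ha⟩

theorem isMaximumMatching_of_disjoint (hME : M ⊆ E) (hM : IsMatching M)
    (hdis : ∀ v, InE E M v → ¬ InO E M v) : IsMaximumMatching E M :=
  ⟨hME, hM, fun _ hNE hN =>
    (card_le_coverSize hM hN hNE).1.trans (coverSize_le_of_disjoint hdis)⟩

/-- A matching that is not maximum can be augmented. -/
theorem exists_augmentation (hME : M ⊆ E) (hM : IsMatching M) (hmax : ¬ IsMaximumMatching E M) :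
    ∃ N ⊆ E, IsMatching N ∧ M.card < N.card ∧ ∀ v, Covered M v → Covered N v := by
  by_contra hno
  refine hmax (isMaximumMatching_of_disjoint hME hM fun v h h' => hno ?_)
  obtain ⟨r, hr, hrv⟩ := altReach_iff_rootReach.1 h
  obtain ⟨s, hs, hsv⟩ := altReach_iff_rootReach.1 h'
  exact (hrv.reverse hsv).exists_augmentation hME hM hs hr

theorem exists_maximum_augmentation (M : Edges n) (hME : M ⊆ E) (hM : IsMatching M) :
    ∃ N, IsMaximumMatching E N ∧ ∀ v, Covered M v → Covered N v := by
  by_cases hmax : IsMaximumMatching E M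
  · exact ⟨M, hmax, fun _ h => h⟩
  obtain ⟨M', hM'E, hM', hlt, hcov⟩ := exists_augmentation hME hM hmax
  have := Finset.card_le_card hM'E
  obtain ⟨N, hN, hNcov⟩ := exists_maximum_augmentation M' hM'E hM'
  exact ⟨N, hN, fun v hv => hNcov v (hcov v hv)⟩
termination_by E.card - M.card

/-! ### Interchanging agents and houses -/

/-- The graph with the roles of agents and houses interchanged. -/
def swapSides (E : Edges n) : Edges n := E.map (Equiv.prodComm _ _).toEmbedding

@[simp] theorem mem_swapSides {a h : Fin n} : (h, a) ∈ swapSides E ↔ (a, h) ∈ E := by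
  simp [swapSides]

@[simp] theorem swapSides_swapSides : swapSides (swapSides E) = E := by
  ext ⟨a, h⟩; simp

theorem swapSides_sdiff : swapSides (E \ M) = swapSides E \ swapSides M := by
  ext ⟨a, h⟩; simp

theorem IsMatching.swapSides (hM : IsMatching M) : IsMatching (swapSides M) := by
  rintro ⟨h, a⟩ he ⟨h', a'⟩ he' hor
  have := hM _ (mem_swapSides.1 he) _ (mem_swapSides.1 he') hor.symm
  simp_all

theorem IsMaximumMatching.swapSides (hM : IsMaximumMatching E M) :
    IsMaximumMatching (swapSides E) (swapSides M) := by
  refine ⟨Finset.map_subset_map.2 hM.1, hM.2.1.swapSides, fun N hNE hN => ?_⟩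
  have := hM.2.2 (HouseAllocation.swapSides N) ?_ hN.swapSides
  · simpa [HouseAllocation.swapSides] using this
  · rintro ⟨a, h⟩ he
    exact mem_swapSides.1 (hNE (mem_swapSides.1 he))

theorem joined_swapSides {v w : Fin n ⊕ Fin n} :
    Joined (swapSides E) v.swap w.swap ↔ Joined E v w := by
  rcases v with a | x <;> rcases w with b | y <;> simp [Joined]

theorem covered_swapSides {v : Fin n ⊕ Fin n} : Covered (swapSides M) v.swap ↔ Covered M v := by
  rcases v with a | x <;> simp [Covered]

theorem AltReach.swapSides {b : Bool} {v : Fin n ⊕ Fin n} (h : AltReach E M b v) :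
    AltReach (swapSides E) (swapSides M) b v.swap := by
  induction h with
  | start v hv => exact .start _ (by rwa [covered_swapSides])
  | unmatchedStep v w _ hw ih =>
    refine .unmatchedStep _ _ ih ?_
    rwa [← swapSides_sdiff, joined_swapSides]
  | matchedStep v w _ hw ih => exact .matchedStep _ _ ih (by rwa [joined_swapSides])

theorem altReach_swapSides {b : Bool} {v : Fin n ⊕ Fin n} :
    AltReach (swapSides E) (swapSides M) b v.swap ↔ AltReach E M b v := by
  refine ⟨fun h => ?_, fun h => h.swapSides⟩
  simpa using h.swapSides

/-! ### Independence of the maximum matching -/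

theorem IsMaximumMatching.coverSize_le (hM : IsMaximumMatching E M)
    (hN : IsMaximumMatching E N) : coverSize E M ≤ N.card :=
  (coverSize_le_of_disjoint fun _ => hM.not_inO_of_inE).trans (hN.2.2 M hM.1 hM.2.1)

theorem IsMaximumMatching.covered_of_not_inE {v : Fin n ⊕ Fin n} (hM : IsMaximumMatching E M)
    (hN : IsMaximumMatching E N) (hv : ¬ InE E M v) : Covered N v := by
  rcases v with a | h
  · exact ((card_le_coverSize hM.2.1 hN.2.1 hN.1).2 (hM.coverSize_le hN)).1 a hv
  · have hM' := hM.swapSides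
    have hN' := hN.swapSides
    have := ((card_le_coverSize hM'.2.1 hN'.2.1 hN'.1).2 (hM'.coverSize_le hN')).1 h
      (fun hE => hv (altReach_swapSides.1 hE))
    exact covered_swapSides.1 this

theorem IsMaximumMatching.exists_joined_of_inO {v : Fin n ⊕ Fin n} (hM : IsMaximumMatching E M)
    (hN : IsMaximumMatching E N) (hv : InO E M v) : ∃ w, InE E M w ∧ Joined N v w := by
  rcases v with a | h
  · have hM' := hM.swapSides
    have hN' := hN.swapSides
    obtain ⟨h, hh, hmem⟩ :=
      ((card_le_coverSize hM'.2.1 hN'.2.1 hN'.1).2 (hM'.coverSize_le hN')).2 a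
        (altReach_swapSides (v := .inl a).2 hv)
    exact ⟨.inr h, altReach_swapSides.1 hh, mem_swapSides.1 hmem⟩
  · obtain ⟨a, ha, hmem⟩ :=
      ((card_le_coverSize hM.2.1 hN.2.1 hN.1).2 (hM.coverSize_le hN)).2 h hv
    exact ⟨.inl a, ha, hmem⟩

theorem IsMaximumMatching.altReach_of_altReach {b : Bool} {v : Fin n ⊕ Fin n}
    (hM : IsMaximumMatching E M) (hN : IsMaximumMatching E N) (h : AltReach E N b v) :
    AltReach E M b v := by
  induction h with
  | start v hv => exact not_not.1 fun hE => hv (hM.covered_of_not_inE hN hE)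
  | unmatchedStep v w _ hw ih =>
    exact InE.inO_of_joined hM.2.1 ih (hw.mono Finset.sdiff_subset)
  | matchedStep v w _ hw ih =>
    obtain ⟨u, hu, hvu⟩ := hM.exists_joined_of_inO hN ih
    rw [hN.2.1.joined_unique hw hvu]
    exact hu

/-- The Dulmage–Mendelsohn decomposition does not depend on the maximum matching. -/
theorem IsMaximumMatching.altReach_iff {b : Bool} {v : Fin n ⊕ Fin n}
    (hM : IsMaximumMatching E M) (hN : IsMaximumMatching E N) :
    AltReach E M b v ↔ AltReach E N b v :=
  ⟨hN.altReach_of_altReach hM, hM.altReach_of_altReach hN⟩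

theorem mem_forbiddenEdges {e : Fin n × Fin n} : e ∈ forbiddenEdges E M ↔ e ∈ E ∧
    ((InO E M (.inl e.1) ∧ InO E M (.inr e.2)) ∨ (InO E M (.inl e.1) ∧ InU E M (.inr e.2)) ∨
    (InU E M (.inl e.1) ∧ InO E M (.inr e.2))) := by
  classical
  unfold forbiddenEdges
  simp

theorem forbiddenEdges_subset : forbiddenEdges E M ⊆ E :=
  fun _ he => (mem_forbiddenEdges.1 he).1

theorem IsMaximumMatching.not_mem_forbiddenEdges (hM : IsMaximumMatching E M)
    (hN : IsMaximumMatching E N) {e : Fin n × Fin n} (he : e ∈ N) : e ∉ forbiddenEdges E M := by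
  have key : ∀ v w, Joined N v w → InO E M v → InE E M w := by
    intro v w hvw hv
    obtain ⟨u, hu, hvu⟩ := hM.exists_joined_of_inO hN hv
    rwa [hN.2.1.joined_unique hvw hvu]
  have h1 := key (.inl e.1) (.inr e.2) he
  have h2 := key (.inr e.2) (.inl e.1) he
  intro hf
  rcases (mem_forbiddenEdges.1 hf).2 with ⟨ha, hb⟩ | ⟨ha, hb⟩ | ⟨ha, hb⟩
  · exact hM.not_inO_of_inE (h1 ha) hb
  · exact hb.1 (h1 ha)
  · exact ha.1 (h2 hb)

theorem IsMaximumMatching.not_mem_forbiddenEdges_of_inE (hM : IsMaximumMatching E M)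
    {e : Fin n × Fin n} (he : InE E M (.inl e.1) ∨ InE E M (.inr e.2)) :
    e ∉ forbiddenEdges E M := by
  intro hf
  have h1 := @IsMaximumMatching.not_inO_of_inE _ _ _ (.inl e.1) hM
  have h2 := @IsMaximumMatching.not_inO_of_inE _ _ _ (.inr e.2) hM
  rcases (mem_forbiddenEdges.1 hf).2 with ⟨ha, hb⟩ | ⟨ha, hb⟩ | ⟨ha, hb⟩ <;>
    simp_all [InU]

/-- A matching without forbidden edges that covers all vertices outside `𝓔` is maximum. -/
theorem IsMaximumMatching.isMaximumMatching_of_covered (hM : IsMaximumMatching E M)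
    (hNE : N ⊆ E) (hN : IsMatching N) (hcov : ∀ v, ¬ InE E M v → Covered N v)
    (hforb : ∀ e ∈ N, e ∉ forbiddenEdges E M) : IsMaximumMatching E N := by
  refine ⟨hNE, hN, fun N' hN'E hN' => (card_le_coverSize hM.2.1 hN' hN'E).1.trans ?_⟩
  refine coverSize_le_card (fun a ha => hcov _ ha) fun h hh => ?_
  obtain ⟨a, ha⟩ := hcov (.inr h) fun hE => hM.not_inO_of_inE hE hh
  refine ⟨a, not_not.1 fun hE => hforb _ ha (mem_forbiddenEdges.2 ⟨hNE ha, ?_⟩), ha⟩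
  by_cases hO : InO E M (.inl a)
  · exact Or.inl ⟨hO, hh⟩
  · exact Or.inr (Or.inr ⟨⟨hE, hO⟩, hh⟩)

end DulmageMendelsohn

open Classical in
theorem nonempty_choices (n : ℕ) : Nonempty (Choices n) := by
  have h : ∀ E M : Edges n, ∃ N, M ⊆ E → IsMatching M →
      IsMaximumMatching E N ∧ ∀ v, Covered M v → Covered N v := by
    intro E M
    by_cases hM : M ⊆ E ∧ IsMatching M
    · obtain ⟨N, hN⟩ := exists_maximum_augmentation M hM.1 hM.2
      exact ⟨N, fun _ _ => hN⟩
    · exact ⟨∅, fun h1 h2 => absurd ⟨h1, h2⟩ hM⟩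
  choose f hf using h
  exact ⟨{ order := fun _ U => U.toList
           order_nodup := fun _ U => U.nodup_toList
           mem_order := fun _ U a => Finset.mem_toList
           augment := fun _ E M => f E M
           augment_maximum := fun _ E M h1 h2 => (hf E M h1 h2).1
           augment_covered := fun _ E M h1 h2 => (hf E M h1 h2).2 }⟩

/-! ### The algorithm of Irving et al. -/

section Irving

variable {n : ℕ} {c : Choices n} {p p' : Profile n} {M N : Edges n} {i j : ℕ}

/-- The vertex `v` is in `𝓔` in round `j` of the algorithm of Irving et al., stated as in the
rules for deletion: it is neither in `𝓤` nor in `𝓞`. -/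
def Live (c : Choices n) (p : Profile n) (j : ℕ) (v : Fin n ⊕ Fin n) : Prop :=
  ¬ (InU (irvingGraph c p j) (irvingMatching c p j) v ∨
    InO (irvingGraph c p j) (irvingMatching c p j) v)

/-- The vertex `v` is in `𝓔` in all of the rounds `1, …, i`. Since a vertex of `𝓞` may return to
`𝓔` in a later round, the last of these rounds does not suffice. -/
def Alive (c : Choices n) (p : Profile n) (i : ℕ) (v : Fin n ⊕ Fin n) : Prop :=
  ∀ j, 1 ≤ j → j ≤ i → Live c p j v

/-- The pairs in `M` of rank at most `i`. -/
def upTo (p : Profile n) (i : ℕ) (M : Edges n) : Edges n :=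
  M.filter (fun e => rank p e.1 e.2 ≤ i)

theorem mem_upTo {e : Fin n × Fin n} : e ∈ upTo p i M ↔ e ∈ M ∧ rank p e.1 e.2 ≤ i :=
  Finset.mem_filter

theorem upTo_subset : upTo p i M ⊆ M := Finset.filter_subset _ _

theorem upTo_mono (hij : i ≤ j) : upTo p i M ⊆ upTo p j M := fun _ he =>
  mem_upTo.2 ⟨(mem_upTo.1 he).1, (mem_upTo.1 he).2.trans hij⟩

theorem one_le_rank (p : Profile n) (a h : Fin n) : 1 ≤ rank p a h := Nat.le_add_left _ _

theorem rank_le (p : Profile n) (a h : Fin n) : rank p a h ≤ n := ((p a).symm h).2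

theorem rank_inj {a h h' : Fin n} (heq : rank p a h = rank p a h') : h = h' :=
  (p a).symm.injective (Fin.ext (Nat.succ_injective heq))

theorem upTo_top : upTo p n M = M := Finset.filter_true_of_mem fun e _ => rank_le p e.1 e.2

theorem Alive.mono {v : Fin n ⊕ Fin n} (h : Alive c p j v) (hij : i ≤ j) : Alive c p i v :=
  fun k h1 h2 => h k h1 (h2.trans hij)

theorem alive_zero {v : Fin n ⊕ Fin n} : Alive c p 0 v := fun _ h1 h2 => by omega

theorem alive_succ {v : Fin n ⊕ Fin n} :
    Alive c p (i + 1) v ↔ Alive c p i v ∧ Live c p (i + 1) v := by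
  refine ⟨fun h => ⟨h.mono (Nat.le_succ i), h _ (by omega) le_rfl⟩, fun h j h1 h2 => ?_⟩
  rcases Nat.lt_or_ge i j with hj | hj
  · rw [show j = i + 1 by omega]; exact h.2
  · exact h.1 j h1 hj

theorem Live.inE {v : Fin n ⊕ Fin n} (h : Live c p j v) :
    InE (irvingGraph c p j) (irvingMatching c p j) v := by
  unfold Live at h
  by_contra hE
  by_cases hO : InO (irvingGraph c p j) (irvingMatching c p j) v
  · exact h (Or.inr hO)
  · exact h (Or.inl ⟨hE, hO⟩)

theorem mem_deleted {e : Fin n × Fin n} : e ∈ (irving c p i).1 ↔ ∃ j, 1 ≤ j ∧ j ≤ i ∧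
    ((j < rank p e.1 e.2 ∧ ¬ (Live c p j (.inl e.1) ∧ Live c p j (.inr e.2))) ∨
      e ∈ forbiddenEdges (irvingGraph c p j) (irvingMatching c p j)) := by
  classical
  induction i with
  | zero => simp [irving]
  | succ i ih =>
    have hstep : e ∈ (irving c p (i + 1)).1 ↔ e ∈ (irving c p i).1 ∨
        ((i + 1 < rank p e.1 e.2 ∧
          ¬ (Live c p (i + 1) (.inl e.1) ∧ Live c p (i + 1) (.inr e.2))) ∨
        e ∈ forbiddenEdges (irvingGraph c p (i + 1)) (irvingMatching c p (i + 1))) := by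
      unfold Live irvingGraph irvingMatching
      rw [← or_assoc]
      simp only [irving, Finset.mem_union, Finset.mem_filter, Finset.mem_univ, true_and,
        Nat.add_sub_cancel]
      tauto
    rw [hstep, ih]
    constructor
    · rintro (⟨j, h1, h2, h⟩ | h)
      · exact ⟨j, h1, by omega, h⟩
      · exact ⟨i + 1, by omega, le_rfl, h⟩
    · rintro ⟨j, h1, h2, h⟩
      rcases Nat.lt_or_ge i j with hj | hj
      · rw [show j = i + 1 by omega] at h
        exact Or.inr h
      · exact Or.inl ⟨j, h1, hj, h⟩

theorem mem_irvingGraph_succ {e : Fin n × Fin n} : e ∈ irvingGraph c p (i + 1) ↔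
    rank p e.1 e.2 ≤ i + 1 ∧ e ∉ (irving c p i).1 := by
  simp [irvingGraph, rankGraph]

theorem rank_le_of_mem_irvingGraph {e : Fin n × Fin n} (he : e ∈ irvingGraph c p i) :
    rank p e.1 e.2 ≤ i := by
  simp only [irvingGraph, rankGraph, Finset.mem_filter] at he
  exact he.2.1

theorem mem_irvingGraph {e : Fin n × Fin n} (hi : 1 ≤ i) : e ∈ irvingGraph c p i ↔
    rank p e.1 e.2 ≤ i ∧
    (∀ j, 1 ≤ j → j < rank p e.1 e.2 → Live c p j (.inl e.1) ∧ Live c p j (.inr e.2)) ∧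
    (∀ j, rank p e.1 e.2 ≤ j → j < i →
      e ∉ forbiddenEdges (irvingGraph c p j) (irvingMatching c p j)) := by
  obtain ⟨i, rfl⟩ : ∃ k, i = k + 1 := ⟨i - 1, by omega⟩
  rw [mem_irvingGraph_succ, mem_deleted]
  have h1r := one_le_rank p e.1 e.2
  constructor
  · rintro ⟨hr, hD⟩
    refine ⟨hr, fun j h1 h2 => ?_, fun j h1 h2 hf => ?_⟩
    · by_contra hL
      exact hD ⟨j, h1, by omega, Or.inl ⟨h2, hL⟩⟩
    · exact hD ⟨j, by omega, by omega, Or.inr hf⟩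
  · rintro ⟨hr, hL, hF⟩
    refine ⟨hr, ?_⟩
    rintro ⟨j, h1, h2, h | h⟩
    · exact h.2 (hL j h1 h.1)
    · have := rank_le_of_mem_irvingGraph (forbiddenEdges_subset h)
      exact hF j this (by omega) h

theorem irvingMatching_succ : irvingMatching c p (i + 1) =
    c.augment (i + 1) (irvingGraph c p (i + 1)) (irvingMatching c p i) := rfl

theorem irvingMatching_invariant (c : Choices n) (p : Profile n) (i : ℕ) :
    irvingMatching c p i ⊆ irvingGraph c p (i + 1) ∧ IsMatching (irvingMatching c p i) ∧
      (1 ≤ i → IsMaximumMatching (irvingGraph c p i) (irvingMatching c p i)) := by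
  induction i with
  | zero =>
    refine ⟨?_, isMatching_empty, by omega⟩
    exact Finset.empty_subset _
  | succ i ih =>
    have hmax : IsMaximumMatching (irvingGraph c p (i + 1)) (irvingMatching c p (i + 1)) :=
      c.augment_maximum (i + 1) _ _ ih.1 ih.2.1
    refine ⟨fun e he => ?_, hmax.2.1, fun _ => hmax⟩
    obtain ⟨h1, h2, h3⟩ := (mem_irvingGraph (by omega)).1 (hmax.1 he)
    refine (mem_irvingGraph (by omega)).2 ⟨by omega, h2, fun j hj1 hj2 => ?_⟩
    rcases Nat.lt_or_ge j (i + 1) with hj | hj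
    · exact h3 j hj1 hj
    · rw [show j = i + 1 by omega]
      exact hmax.not_mem_forbiddenEdges hmax he

theorem isMaximumMatching_irvingMatching (hi : 1 ≤ i) :
    IsMaximumMatching (irvingGraph c p i) (irvingMatching c p i) :=
  (irvingMatching_invariant c p i).2.2 hi

theorem isMatching_irvingMatching : IsMatching (irvingMatching c p i) :=
  (irvingMatching_invariant c p i).2.1

theorem covered_irvingMatching_mono {v : Fin n ⊕ Fin n} (hij : i ≤ j)
    (h : Covered (irvingMatching c p i) v) : Covered (irvingMatching c p j) v := by
  induction j, hij using Nat.le_induction with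
  | base => exact h
  | succ j _ ih =>
    exact c.augment_covered (j + 1) _ _ (irvingMatching_invariant c p j).1
      (irvingMatching_invariant c p j).2.1 v ih

/-- In every round `j ≤ i`, the pairs of rank at most `j` in `N` form a maximum matching of the
graph of the algorithm of Irving et al. For `i = n` this characterizes rank-maximality. -/
def Good (c : Choices n) (p : Profile n) (i : ℕ) (N : Edges n) : Prop :=
  ∀ j, 1 ≤ j → j ≤ i → IsMaximumMatching (irvingGraph c p j) (upTo p j N)

theorem Good.mono (h : Good c p j N) (hij : i ≤ j) : Good c p i N :=
  fun k h1 h2 => h k h1 (h2.trans hij)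

theorem Good.live_iff {v : Fin n ⊕ Fin n} (hN : Good c p i N) (h1 : 1 ≤ j) (hj : j ≤ i) :
    Live c p j v ↔ InE (irvingGraph c p j) (upTo p j N) v := by
  have hM := isMaximumMatching_irvingMatching (c := c) (p := p) h1
  rw [InE, ← hM.altReach_iff (hN j h1 hj)]
  refine ⟨Live.inE, fun h => ?_⟩
  rintro (hU | hO)
  · exact hU.1 h
  · exact hM.not_inO_of_inE h hO

theorem Good.live_of_not_covered {v : Fin n ⊕ Fin n} (hN : Good c p i N) (h1 : 1 ≤ j)
    (hj : j ≤ i) (hv : ¬ Covered (upTo p j N) v) : Live c p j v :=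
  (hN.live_iff h1 hj).2 (inE_of_not_covered hv)

theorem Good.alive_of_not_covered {v : Fin n ⊕ Fin n} (hN : Good c p i N)
    (hj : j ≤ i) (hv : ¬ Covered (upTo p j N) v) : Alive c p j v := fun _ h1 hk =>
  hN.live_of_not_covered h1 (hk.trans hj) fun hc => hv (hc.mono (upTo_mono hk))

theorem Good.not_mem_forbiddenEdges (hN : Good c p i N) (h1 : 1 ≤ j) (hj : j ≤ i)
    {e : Fin n × Fin n} (he : e ∈ upTo p j N) :
    e ∉ forbiddenEdges (irvingGraph c p j) (irvingMatching c p j) :=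
  (isMaximumMatching_irvingMatching h1).not_mem_forbiddenEdges (hN j h1 hj) he

theorem Live.not_mem_forbiddenEdges {e : Fin n × Fin n} (h1 : 1 ≤ j)
    (h : Live c p j (.inl e.1) ∨ Live c p j (.inr e.2)) :
    e ∉ forbiddenEdges (irvingGraph c p j) (irvingMatching c p j) :=
  (isMaximumMatching_irvingMatching h1).not_mem_forbiddenEdges_of_inE (h.imp Live.inE Live.inE)

/-- A matching that is good up to round `i` contains no deleted edge of rank at most `i + 1`: a
vertex that is no longer in `𝓔` is already covered by a pair of smaller rank. -/
theorem Good.upTo_succ_subset (hN : Good c p i N) (hmat : IsMatching N) :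
    upTo p (i + 1) N ⊆ irvingGraph c p (i + 1) := by
  intro e he
  obtain ⟨heN, hr⟩ := mem_upTo.1 he
  have h1r := one_le_rank p e.1 e.2
  -- A pair of `N` of smaller rank that shares a vertex with `e` would be `e` itself.
  have key : ∀ j v w, 1 ≤ j → j < rank p e.1 e.2 → Joined {e} v w → Live c p j v := by
    intro j v w h1 hj hvw
    refine hN.live_of_not_covered h1 (by omega) fun hc => ?_
    obtain ⟨u, hu⟩ := hc.exists_joined
    have heq := hmat.joined_unique (hvw.mono (Finset.singleton_subset_iff.2 heN))
      (hu.mono upTo_subset)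
    rw [← heq] at hu
    have : e ∈ upTo p j N := by
      rcases v with a | x <;> rcases w with b | y
      · exact hvw.elim
      · rw [← Finset.mem_singleton.1 hvw]; exact hu
      · rw [← Finset.mem_singleton.1 hvw]; exact hu
      · exact hvw.elim
    have := (mem_upTo.1 this).2
    omega
  refine (mem_irvingGraph (by omega)).2 ⟨hr, fun j h1 hj => ⟨?_, ?_⟩, fun j hj1 hj2 => ?_⟩
  · exact key j _ (.inr e.2) h1 hj (Finset.mem_singleton_self e)
  · exact key j _ (.inl e.1) h1 hj (Finset.mem_singleton_self e)
  · exact hN.not_mem_forbiddenEdges (by omega) (by omega) (mem_upTo.2 ⟨heN, hj1⟩)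

theorem good_irvingMatching (c : Choices n) (p : Profile n) (i : ℕ) :
    Good c p i (irvingMatching c p i) := by
  intro j h1 hj
  have hMi := isMaximumMatching_irvingMatching (c := c) (p := p) (h1.trans hj)
  have hMj := isMaximumMatching_irvingMatching (c := c) (p := p) h1
  have hsub : ∀ e ∈ upTo p j (irvingMatching c p i), e ∈ irvingGraph c p j ∧
      (j < i → e ∉ forbiddenEdges (irvingGraph c p j) (irvingMatching c p j)) := by
    intro e he
    obtain ⟨heM, hr⟩ := mem_upTo.1 he
    obtain ⟨-, h2, h3⟩ := (mem_irvingGraph (h1.trans hj)).1 (hMi.1 heM)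
    exact ⟨(mem_irvingGraph h1).2 ⟨hr, h2, fun k hk1 hk2 => h3 k hk1 (by omega)⟩, h3 j hr⟩
  rcases hj.eq_or_lt with rfl | hj
  · have : upTo p j (irvingMatching c p j) = irvingMatching c p j :=
      Finset.filter_true_of_mem fun e he => rank_le_of_mem_irvingGraph (hMi.1 he)
    rwa [this]
  refine hMj.isMaximumMatching_of_covered (fun e he => (hsub e he).1)
    (hMi.2.1.subset upTo_subset) (fun v hv => ?_) fun e he => (hsub e he).2 hj
  have hc := covered_irvingMatching_mono hj.le (not_not.1 fun hc => hv (inE_of_not_covered hc))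
  obtain ⟨w, hw⟩ := hc.exists_joined
  have hnl : ¬ Live c p j v := fun h => hv h.inE
  have : Joined (upTo p j (irvingMatching c p i)) v w := by
    rcases v with a | x <;> rcases w with b | y
    · exact hw
    · refine mem_upTo.2 ⟨hw, not_lt.1 fun hlt => hnl ?_⟩
      exact (((mem_irvingGraph (h1.trans hj.le)).1 (hMi.1 hw)).2.1 j h1 hlt).1
    · refine mem_upTo.2 ⟨hw, not_lt.1 fun hlt => hnl ?_⟩
      exact (((mem_irvingGraph (h1.trans hj.le)).1 (hMi.1 hw)).2.1 j h1 hlt).2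
    · exact hw
  exact this.covered

/-! ### Rank-maximality -/

theorem card_upTo_succ (hM : IsMatching M) :
    (upTo p (i + 1) M).card = (upTo p i M).card + rankCount p M (i + 1) := by
  classical
  have hset : {a : Fin n | ∃ h, (a, h) ∈ M ∧ rank p a h = i + 1} =
      ((M.filter (fun e => rank p e.1 e.2 = i + 1)).image Prod.fst : Finset (Fin n)) := by
    ext a
    simp only [Set.mem_ofPred_eq, Finset.coe_image, Set.mem_image, Finset.mem_coe,
      Finset.mem_filter]
    constructor
    · rintro ⟨h, hm, hr⟩; exact ⟨(a, h), ⟨hm, hr⟩, rfl⟩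
    · rintro ⟨⟨b, h⟩, ⟨hm, hr⟩, rfl⟩; exact ⟨h, hm, hr⟩
  rw [rankCount, hset, Set.ncard_coe_finset, Finset.card_image_of_injOn,
    ← Finset.card_union_of_disjoint]
  · congr 1
    ext e
    simp only [upTo, Finset.mem_union, Finset.mem_filter, Nat.le_succ_iff, Nat.succ_eq_add_one]
    tauto
  · refine Finset.disjoint_left.2 fun e he he' => ?_
    have := (mem_upTo.1 he).2
    have := (Finset.mem_filter.1 he').2
    omega
  · intro e he f hf hef
    exact hM e (Finset.mem_filter.1 he).1 f (Finset.mem_filter.1 hf).1 (Or.inl hef)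

theorem card_upTo_zero : (upTo p 0 M).card = 0 := by
  rw [Finset.card_eq_zero, upTo, Finset.filter_eq_empty_iff]
  intro e _
  have := one_le_rank p e.1 e.2
  omega

/-- Rank-domination in terms of the numbers of pairs of rank at most `l`. -/
theorem rankDominates_iff (hM : IsMatching M) (hN : IsMatching N) : RankDominates p N M ↔
    ∃ l, 1 ≤ l ∧ l ≤ n ∧ (∀ k < l, (upTo p k M).card = (upTo p k N).card) ∧
      (upTo p l M).card < (upTo p l N).card := by
  unfold RankDominates
  constructor
  · rintro ⟨l, hl, heq, hlt⟩
    rw [Finset.mem_Icc] at hl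
    have key : ∀ k < l, (upTo p k M).card = (upTo p k N).card := by
      intro k hk
      induction k with
      | zero => rw [card_upTo_zero, card_upTo_zero]
      | succ k ih =>
        rw [card_upTo_succ hM, card_upTo_succ hN, ih (by omega),
          heq (k + 1) (Finset.mem_Icc.2 ⟨by omega, by omega⟩)]
    refine ⟨l, hl.1, hl.2, key, ?_⟩
    obtain ⟨l, rfl⟩ : ∃ m, l = m + 1 := ⟨l - 1, by omega⟩
    have := key l (by omega)
    rw [card_upTo_succ hM, card_upTo_succ hN]
    omega
  · rintro ⟨l, h1, hn, heq, hlt⟩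
    refine ⟨l, Finset.mem_Icc.2 ⟨h1, hn⟩, fun k hk => ?_, ?_⟩
    · rw [Finset.mem_Icc] at hk
      obtain ⟨k, rfl⟩ : ∃ m, k = m + 1 := ⟨k - 1, by omega⟩
      have h1 := heq k (by omega)
      have h2 := heq (k + 1) (by omega)
      rw [card_upTo_succ hM, card_upTo_succ hN] at h2
      omega
    · obtain ⟨l, rfl⟩ : ∃ m, l = m + 1 := ⟨l - 1, by omega⟩
      have h1 := heq l (by omega)
      rw [card_upTo_succ hM, card_upTo_succ hN] at hlt
      omega

theorem Good.card_eq (hM : Good c p i M) (hN : Good c p i N) (hj : j ≤ i) :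
    (upTo p j M).card = (upTo p j N).card := by
  rcases Nat.eq_zero_or_pos j with rfl | h1
  · rw [card_upTo_zero, card_upTo_zero]
  · have h := hM j h1 hj
    have h' := hN j h1 hj
    exact le_antisymm (h'.2.2 _ h.1 h.2.1) (h.2.2 _ h'.1 h'.2.1)

/-- A matching that is good up to round `i` and has as many pairs of rank at most `i + 1` as some
matching that is good up to round `i + 1` is good up to round `i + 1` itself. -/
theorem Good.succ (hN : Good c p i N) (hmat : IsMatching N) (hM : Good c p (i + 1) M)
    (hcard : (upTo p (i + 1) M).card ≤ (upTo p (i + 1) N).card) : Good c p (i + 1) N := by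
  intro j h1 hj
  rcases Nat.lt_or_ge i j with hij | hij
  · obtain rfl : j = i + 1 := by omega
    exact ⟨hN.upTo_succ_subset hmat, hmat.subset upTo_subset, fun N' hN'E hN' =>
      ((hM _ h1 hj).2.2 N' hN'E hN').trans hcard⟩
  · exact hN j h1 hij

/-- The algorithm of Irving et al. characterizes the rank-maximal matchings. -/
theorem isRankMaximal_iff_good (c : Choices n) :
    IsRankMaximal p M ↔ IsMatching M ∧ Good c p n M := by
  constructor
  · rintro ⟨hM, hdom⟩
    refine ⟨hM, ?_⟩
    suffices ∀ i ≤ n, Good c p i M from this n le_rfl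
    intro i
    induction i with
    | zero => exact fun _ j h1 h2 => by omega
    | succ i ih =>
      intro hi
      have hI := good_irvingMatching c p (i + 1)
      refine (ih (by omega)).succ hM hI (not_lt.1 fun hlt => ?_)
      refine hdom _ isMatching_irvingMatching
        ((rankDominates_iff hM isMatching_irvingMatching).2 ⟨i + 1, by omega, hi, ?_, hlt⟩)
      intro k hk
      exact (ih (by omega)).card_eq (hI.mono (Nat.le_succ i)) (by omega)
  · rintro ⟨hM, hG⟩
    refine ⟨hM, fun N hN hdom => ?_⟩
    obtain ⟨l, h1, hn, heq, hlt⟩ := (rankDominates_iff hM hN).1 hdom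
    have key : ∀ k < l, Good c p k N := by
      intro k
      induction k with
      | zero => exact fun _ j h1 h2 => by omega
      | succ k ih =>
        exact fun hk => (ih (by omega)).succ hN (hG.mono (by omega)) (heq _ hk).le
    obtain ⟨l, rfl⟩ : ∃ m, l = m + 1 := ⟨l - 1, by omega⟩
    have := (hG (l + 1) h1 hn).2.2 _ ((key l (by omega)).upTo_succ_subset hN)
      (hN.subset upTo_subset)
    omega

end Irving

/-! ### The elicitation algorithm -/

section Algorithm

variable {n : ℕ} {c : Choices n} {p p' : Profile n} {M N : Edges n} {i j : ℕ}

/-- An edge between two vertices of `𝓔` would allow an augmentation. -/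
theorem Alive.lt_rank {a h : Fin n} (ha : Alive c p i (.inl a)) (hh : Alive c p i (.inr h)) :
    i < rank p a h := by
  by_contra hlt
  have hle : rank p a h ≤ i := not_lt.1 hlt
  have h1 := one_le_rank p a h
  have hmax := isMaximumMatching_irvingMatching (c := c) (p := p) h1
  have hmem : (a, h) ∈ irvingGraph c p (rank p a h) := (mem_irvingGraph h1).2
    ⟨le_rfl, fun j hj1 hj2 => ⟨ha j hj1 (hj2.le.trans hle), hh j hj1 (hj2.le.trans hle)⟩,
      fun j hj1 hj2 => absurd hj2 (not_lt.2 hj1)⟩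
  refine hh _ h1 (by omega) (Or.inr ?_)
  exact (ha _ h1 (by omega)).inE.inO_of_joined hmax.2.1 (w := .inr h) hmem

theorem mem_irvingGraph_succ_iff {e : Fin n × Fin n} : e ∈ irvingGraph c p (i + 1) ↔
    (rank p e.1 e.2 ≤ i ∧ e ∉ (irving c p i).1) ∨
      (rank p e.1 e.2 = i + 1 ∧ Alive c p i (.inl e.1) ∧ Alive c p i (.inr e.2)) := by
  rw [mem_irvingGraph_succ]
  have key : rank p e.1 e.2 = i + 1 →
      (e ∉ (irving c p i).1 ↔ Alive c p i (.inl e.1) ∧ Alive c p i (.inr e.2)) := by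
    intro hr
    rw [mem_deleted]
    constructor
    · intro hD
      have : ∀ j, 1 ≤ j → j ≤ i → Live c p j (.inl e.1) ∧ Live c p j (.inr e.2) := by
        intro j h1 hj
        by_contra hL
        exact hD ⟨j, h1, hj, Or.inl ⟨by omega, hL⟩⟩
      exact ⟨fun j h1 hj => (this j h1 hj).1, fun j h1 hj => (this j h1 hj).2⟩
    · rintro ⟨ha, hh⟩ ⟨j, h1, hj, ⟨-, hL⟩ | hf⟩
      · exact hL ⟨ha j h1 hj, hh j h1 hj⟩
      · have := rank_le_of_mem_irvingGraph (forbiddenEdges_subset hf)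
        omega
  constructor
  · rintro ⟨hr, hD⟩
    rcases Nat.lt_or_ge i (rank p e.1 e.2) with h | h
    · have hr' : rank p e.1 e.2 = i + 1 := by omega
      exact Or.inr ⟨hr', (key hr').1 hD⟩
    · exact Or.inl ⟨h, hD⟩
  · rintro (⟨hr, hD⟩ | ⟨hr, hA⟩)
    · exact ⟨by omega, hD⟩
    · exact ⟨by omega, (key hr).2 hA⟩

namespace Online

theorem run_bind {α β : Type} (x : Online n α) (f : α → Online n β) (hist : History n) :
    (x.bind f).run p hist = (x.run p hist).bind (fun y => (f y.1).run p y.2) := by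
  induction x generalizing hist with
  | ret x => rfl
  | query a next ih =>
    simp only [bind, run]
    cases nextBest p hist a with
    | none => rfl
    | some h => exact ih h _

end Online

theorem numAsked_append (l₁ l₂ : History n) (a : Fin n) :
    numAsked (l₁ ++ l₂) a = numAsked l₁ a + numAsked l₂ a := List.countP_append ..

theorem numAsked_cons (e : Fin n × Fin n) (l : History n) (a : Fin n) :
    numAsked (e :: l) a = numAsked l a + if e.1 = a then 1 else 0 := by
  simp [numAsked, List.countP_cons]

theorem consistent_nil : Consistent p [] := by
  intro l₁ l₂ a h heq
  simp at heq

theorem Consistent.append_singleton {hist : History n} {a h : Fin n} (hc : Consistent p hist)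
    (hn : nextBest p hist a = some h) : Consistent p (hist ++ [(a, h)]) := by
  intro l₁ l₂ b g heq
  rcases List.eq_nil_or_concat l₂ with rfl | ⟨l₂, e, rfl⟩
  · obtain ⟨rfl, heq'⟩ := List.append_inj' heq rfl
    simp only [List.cons.injEq, Prod.mk.injEq, and_true] at heq'
    rw [← heq'.1, ← heq'.2, hn]
  · refine hc l₁ l₂ b g ?_
    rw [List.concat_eq_append, ← List.cons_append, ← List.append_assoc] at heq
    exact (List.append_inj' heq rfl).1

namespace Online

/-- A run only extends the history, and it records the true answers. -/
theorem run_spec {α : Type} (x : Online n α) {hist hist' : History n} {y : α}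
    (hrun : x.run p hist = some (y, hist')) :
    (∃ l, hist' = hist ++ l) ∧ (Consistent p hist → Consistent p hist') := by
  induction x generalizing hist with
  | ret x =>
    simp only [run, Option.some.injEq, Prod.mk.injEq] at hrun
    rw [← hrun.2]
    exact ⟨⟨[], by simp⟩, id⟩
  | query a next ih =>
    simp only [run] at hrun
    cases hnb : nextBest p hist a with
    | none => simp [hnb] at hrun
    | some h =>
      rw [hnb] at hrun
      obtain ⟨⟨l, hl⟩, hc⟩ := ih h hrun
      refine ⟨⟨(a, h) :: l, by rw [hl]; simp⟩, fun hcons => hc (hcons.append_singleton hnb)⟩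

/-- The run of an online algorithm depends only on the recorded answers. -/
theorem run_eq_of_consistent {α : Type} (x : Online n α) {hist hist' : History n} {y : α}
    (hrun : x.run p hist = some (y, hist')) (hc : Consistent p' hist') :
    x.run p' hist = some (y, hist') := by
  induction x generalizing hist with
  | ret x => exact hrun
  | query a next ih =>
    simp only [run] at hrun ⊢
    cases hnb : nextBest p hist a with
    | none => simp [hnb] at hrun
    | some h =>
      rw [hnb] at hrun
      obtain ⟨⟨l, rfl⟩, -⟩ := run_spec _ hrun
      have := hc hist l a h (by simp)
      rw [this]
      exact ih h hrun

end Online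

/-- One query to each agent of a list, where every agent has been asked `m` times before. -/
theorem run_elicitList (l : List (Fin n)) {m : ℕ} (hm : m < n) (hl : l.Nodup) (s : State n)
    (hist : History n) (hask : ∀ a ∈ l, numAsked hist a = m) :
    ∃ s', (elicitList l s).run p hist = some (s', hist ++ l.map (fun a => (a, p a ⟨m, hm⟩))) ∧
      s'.U = s.U ∧ s'.V = s.V ∧ s'.M = s.M ∧ s'.F = s.F ∧
      ∀ e, e ∈ s'.E ↔ e ∈ s.E ∨ (e.1 ∈ l ∧ e.2 = p e.1 ⟨m, hm⟩ ∧ e.2 ∈ s.V ∧ e ∉ s.F) := by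
  induction l generalizing s hist with
  | nil => exact ⟨s, by simp [elicitList, Online.run], by simp⟩
  | cons a l ih =>
    have hnb : nextBest p hist a = some (p a ⟨m, hm⟩) := by
      have := hask a (by simp)
      simp [nextBest, this, hm]
    rw [List.nodup_cons] at hl
    set h := p a ⟨m, hm⟩ with hh
    obtain ⟨s', hrun, hU, hV, hM, hF, hE⟩ := ih hl.2
      (if h ∈ s.V ∧ (a, h) ∉ s.F then { s with E := insert (a, h) s.E } else s)
      (hist ++ [(a, h)]) (by
        intro b hb
        have hab : a ≠ b := fun heq => hl.1 (heq ▸ hb)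
        rw [numAsked_append, numAsked_cons, if_neg hab, hask b (by simp [hb])]
        rfl)
    refine ⟨s', ?_, ?_, ?_, ?_, ?_, ?_⟩
    · simp only [elicitList, Online.run, hnb]
      rw [hrun]
      simp [hh]
    · rw [hU]; split_ifs <;> rfl
    · rw [hV]; split_ifs <;> rfl
    · rw [hM]; split_ifs <;> rfl
    · rw [hF]; split_ifs <;> rfl
    · rintro ⟨b, g⟩
      rw [hE]
      by_cases hab : b = a
      · subst hab
        split_ifs with hif
        · simp only [Finset.mem_insert, Prod.mk.injEq, true_and, List.mem_cons, true_or]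
          constructor
          · rintro ((rfl | h1) | h1)
            · exact Or.inr ⟨hh, hif⟩
            · exact Or.inl h1
            · exact absurd h1.1 hl.1
          · rintro (h1 | h1)
            · exact Or.inl (Or.inr h1)
            · exact Or.inl (Or.inl h1.1)
        · simp only [List.mem_cons, true_or, true_and]
          constructor
          · rintro (h1 | h1)
            · exact Or.inl h1
            · exact absurd h1.1 hl.1
          · rintro (h1 | ⟨rfl, h1⟩)
            · exact Or.inl h1
            · exact absurd h1 hif
      · split_ifs with hif <;> simp [hab]

/-- The state of the main loop after round `m`, in terms of the algorithm of Irving et al. -/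
structure Simulates (c : Choices n) (p : Profile n) (m : ℕ) (s : State n) (hist : History n) :
    Prop where
  mem_U : ∀ a, a ∈ s.U ↔ Alive c p m (.inl a)
  mem_V : ∀ h, h ∈ s.V ↔ Alive c p m (.inr h)
  mem_E : ∀ e, e ∈ s.E ↔ rank p e.1 e.2 ≤ m ∧ e ∉ (irving c p m).1
  eq_M : s.M = irvingMatching c p m
  rank_F : ∀ e ∈ s.F, rank p e.1 e.2 ≤ m
  asked : ∀ a ∈ s.U, numAsked hist a = m

theorem Simulates.exists_run_elicit {m : ℕ} {s : State n} {hist : History n}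
    (hs : Simulates c p m s hist) (hm : m < n) :
    ∃ s' l, (elicit c (m + 1) s).run p hist = some (s', hist ++ l) ∧ l.length = s.U.card ∧
      (∀ a ∈ s.U, numAsked l a = 1) ∧
      s'.U = s.U ∧ s'.V = s.V ∧ s'.M = s.M ∧ s'.F = s.F ∧ s'.E = irvingGraph c p (m + 1) := by
  obtain ⟨s', hrun, hU, hV, hM, hF, hE⟩ := run_elicitList (p := p) (c.order (m + 1) s.U) hm
    (c.order_nodup _ _) s hist (fun a ha => hs.asked a ((c.mem_order _ _ _).1 ha))
  refine ⟨s', _, hrun, ?_, ?_, hU, hV, hM, hF, ?_⟩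
  · rw [List.length_map, ← List.toFinset_card_of_nodup (c.order_nodup _ _)]
    congr 1
    ext a
    rw [List.mem_toFinset, c.mem_order]
  · intro a ha
    rw [numAsked, List.countP_map]
    have : ((fun e : Fin n × Fin n => decide (e.1 = a)) ∘ fun a => (a, p a ⟨m, hm⟩)) =
        fun b => b == a := by
      funext b
      simp [Bool.beq_eq_decide_eq]
    rw [this]
    exact List.count_eq_one_of_mem (c.order_nodup _ _) ((c.mem_order _ _ _).2 ha)
  · ext ⟨a, h⟩
    have hrank : h = p a ⟨m, hm⟩ ↔ rank p a h = m + 1 := by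
      rw [rank, Nat.add_right_cancel_iff, ← Equiv.symm_apply_eq, Fin.ext_iff]
    rw [hE, mem_irvingGraph_succ_iff, hs.mem_E, c.mem_order, hs.mem_U, hs.mem_V, hrank]
    constructor
    · rintro (h1 | h1)
      · exact Or.inl h1
      · exact Or.inr ⟨h1.2.1, h1.1, h1.2.2.1⟩
    · rintro (h1 | h1)
      · exact Or.inl h1
      · refine Or.inr ⟨h1.2.1, h1.1, h1.2.2, fun hf => ?_⟩
        have h2 := hs.rank_F _ hf
        have h3 : rank p a h = m + 1 := h1.1
        have h4 : rank p a h ≤ m := h2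
        omega

open Classical in
theorem exists_run_rounds (c : Choices n) (p : Profile n) (m : ℕ) (hm : m ≤ n) :
    ∃ s hist, (rounds c m).run p [] = some (s, hist) ∧ Simulates c p m s hist ∧
      hist.length = ∑ i ∈ Finset.range m, {a | Alive c p i (.inl a)}.toFinset.card := by
  induction m with
  | zero =>
    refine ⟨State.init n, [], rfl, ⟨?_, ?_, ?_, rfl, ?_, ?_⟩, by simp⟩
    · exact fun a => iff_of_true (Finset.mem_univ a) alive_zero
    · exact fun a => iff_of_true (Finset.mem_univ a) alive_zero
    · intro e
      have := one_le_rank p e.1 e.2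
      simp only [State.init, Finset.notMem_empty, false_iff, not_and]
      omega
    · intro e he
      simp [State.init] at he
    · exact fun a _ => rfl
  | succ m ih =>
    obtain ⟨s, hist, hrun, hs, hlen⟩ := ih (by omega)
    obtain ⟨s', l, hrun', hl, hask, hU, hV, hM, hF, hE⟩ := hs.exists_run_elicit (by omega)
    have hMM : c.augment (m + 1) (irvingGraph c p (m + 1)) s'.M = irvingMatching c p (m + 1) := by
      rw [hM, hs.eq_M, irvingMatching_succ]
    refine ⟨update c (m + 1) s', hist ++ l, ?_, ⟨?_, ?_, ?_, ?_, ?_, ?_⟩, ?_⟩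
    · simp only [rounds, Online.run_bind, hrun, Option.bind_some, hrun']
      rfl
    · intro a
      simp only [update, Finset.mem_filter, hE, hMM, hU, hs.mem_U]
      exact alive_succ.symm
    · intro a
      simp only [update, Finset.mem_filter, hE, hMM, hV, hs.mem_V]
      exact alive_succ.symm
    · intro e
      simp only [update, Finset.mem_sdiff, hE, hMM]
      have h1 := mem_irvingGraph_succ (c := c) (p := p) (i := m) (e := e)
      constructor
      · rintro ⟨he, hf⟩
        refine ⟨(h1.1 he).1, fun hD => (h1.1 he).2 ?_⟩
        obtain ⟨j, hj1, hj2, hj⟩ := mem_deleted.1 hD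
        rcases Nat.lt_or_ge m j with hmj | hmj
        · obtain rfl : j = m + 1 := by omega
          rcases hj with hj | hj
          · have := (h1.1 he).1
            omega
          · exact absurd hj hf
        · exact mem_deleted.2 ⟨j, hj1, hmj, hj⟩
      · rintro ⟨hr, hD⟩
        refine ⟨h1.2 ⟨hr, fun hD' => hD ?_⟩, fun hf => hD ?_⟩
        · obtain ⟨j, hj1, hj2, hj⟩ := mem_deleted.1 hD'
          exact mem_deleted.2 ⟨j, hj1, by omega, hj⟩
        · exact mem_deleted.2 ⟨m + 1, by omega, le_rfl, Or.inr hf⟩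
    · change c.augment (m + 1) s'.E s'.M = _
      rw [hE, hMM]
    · intro e he
      simp only [update, Finset.mem_union, hE, hMM, hF] at he
      rcases he with he | he
      · exact (hs.rank_F e he).trans (Nat.le_succ m)
      · exact rank_le_of_mem_irvingGraph (forbiddenEdges_subset he)
    · intro a ha
      simp only [update, Finset.mem_filter] at ha
      rw [numAsked_append, hs.asked a (hU ▸ ha.1), hask a (hU ▸ ha.1)]
    · rw [List.length_append, hlen, hl, Finset.sum_range_succ]
      congr 2
      ext a
      simp [hs.mem_U]

theorem simulatesIrving (c : Choices n) : SimulatesIrving c := by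
  intro p i hi
  obtain ⟨s, hist, hrun, hs, -⟩ := exists_run_rounds c p i (by omega)
  obtain ⟨s', l, hrun', -, -, -, -, hM, -, hE⟩ := hs.exists_run_elicit (by omega)
  refine ⟨s', hist ++ l, ?_, hE, ?_⟩
  · rw [Online.run_bind, hrun]
    exact hrun'
  · change c.augment (i + 1) s'.E s'.M = _
    rw [hE, hM, hs.eq_M, irvingMatching_succ]

end Algorithm

/-! ### The result is necessarily rank-maximal -/

section Correctness

variable {n : ℕ} {c : Choices n} {p p' : Profile n} {M N : Edges n} {i j : ℕ}

theorem covered_inl {a : Fin n} : Covered M (.inl a) ↔ a ∈ M.image Prod.fst := by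
  simp [Covered]

theorem covered_inr {h : Fin n} : Covered M (.inr h) ↔ h ∈ M.image Prod.snd := by
  simp [Covered]

theorem IsMatching.card_image_fst (hM : IsMatching M) : (M.image Prod.fst).card = M.card :=
  Finset.card_image_of_injOn fun e he f hf hef => hM e he f hf (Or.inl hef)

theorem IsMatching.card_image_snd (hM : IsMatching M) : (M.image Prod.snd).card = M.card :=
  Finset.card_image_of_injOn fun e he f hf hef => hM e he f hf (Or.inr hef)

theorem IsMatching.card_compl_image (hM : IsMatching M) :
    (M.image Prod.fst)ᶜ.card = (M.image Prod.snd)ᶜ.card := by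
  rw [Finset.card_compl, Finset.card_compl, hM.card_image_fst, hM.card_image_snd]

theorem IsMatching.card_le (hM : IsMatching M) : M.card ≤ n := by
  rw [← hM.card_image_fst]
  exact (Finset.card_le_univ _).trans_eq (Fintype.card_fin n)

/-- If an agent is left over, then so is a house. -/
theorem IsMatching.exists_not_covered_house (hM : IsMatching M) {a : Fin n}
    (ha : ¬ Covered M (.inl a)) : ∃ h, ¬ Covered M (.inr h) := by
  have : 0 < (M.image Prod.fst)ᶜ.card :=
    Finset.card_pos.2 ⟨a, Finset.mem_compl.2 (by rwa [← covered_inl])⟩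
  rw [hM.card_compl_image, Finset.card_pos] at this
  obtain ⟨h, hh⟩ := this
  exact ⟨h, by rw [covered_inr]; exact Finset.mem_compl.1 hh⟩

theorem IsMatching.exists_not_covered_agent (hM : IsMatching M) {h : Fin n}
    (hh : ¬ Covered M (.inr h)) : ∃ a, ¬ Covered M (.inl a) := by
  have : 0 < (M.image Prod.snd)ᶜ.card :=
    Finset.card_pos.2 ⟨h, Finset.mem_compl.2 (by rwa [← covered_inr])⟩
  rw [← hM.card_compl_image, Finset.card_pos] at this
  obtain ⟨a, ha⟩ := this
  exact ⟨a, by rw [covered_inl]; exact Finset.mem_compl.1 ha⟩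

theorem mem_complete {e : Fin n × Fin n} : e ∈ complete M ↔
    e ∈ M ∨ (¬ Covered M (.inl e.1) ∧ ¬ Covered M (.inr e.2)) := by
  classical
  simp [complete]

/-- A pair that is left over after `n - 1` rounds has rank `n`, as its edge could have been used
for an augmentation otherwise. -/
theorem rank_eq_of_not_covered {a h : Fin n}
    (ha : ¬ Covered (irvingMatching c p (n - 1)) (.inl a))
    (hh : ¬ Covered (irvingMatching c p (n - 1)) (.inr h)) : rank p a h = n := by
  have hG := good_irvingMatching c p (n - 1)
  have h1 := hG.alive_of_not_covered le_rfl fun hc => ha (hc.mono upTo_subset)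
  have h2 := hG.alive_of_not_covered le_rfl fun hc => hh (hc.mono upTo_subset)
  have := h1.lt_rank h2
  have := rank_le p a h
  omega

theorem isMatching_complete : IsMatching (complete (irvingMatching c p (n - 1))) := by
  have hM := isMatching_irvingMatching (c := c) (p := p) (i := n - 1)
  intro e he f hf hef
  rcases mem_complete.1 he with he | ⟨he1, he2⟩ <;>
    rcases mem_complete.1 hf with hf | ⟨hf1, hf2⟩
  · exact hM e he f hf hef
  · rcases hef with h | h
    · exact absurd ⟨e.2, h ▸ he⟩ hf1
    · exact absurd ⟨e.1, h ▸ he⟩ hf2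
  · rcases hef with h | h
    · exact absurd ⟨f.2, h ▸ hf⟩ he1
    · exact absurd ⟨f.1, h ▸ hf⟩ he2
  · rcases hef with h | h
    · refine Prod.ext h (rank_inj (p := p) (a := e.1) ?_)
      rw [rank_eq_of_not_covered he1 he2, rank_eq_of_not_covered he1 hf2]
    · refine Prod.ext ?_ h
      by_contra hne
      -- Two agents left over would come with two houses left over.
      have : 1 < (irvingMatching c p (n - 1) |>.image Prod.fst)ᶜ.card :=
        Finset.one_lt_card.2 ⟨e.1, Finset.mem_compl.2 (by rwa [← covered_inl]), f.1,
          Finset.mem_compl.2 (by rwa [← covered_inl]), hne⟩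
      rw [hM.card_compl_image] at this
      obtain ⟨x, hx, y, hy, hxy⟩ := Finset.one_lt_card.1 this
      rw [Finset.mem_compl, ← covered_inr] at hx hy
      refine hxy (rank_inj (p := p) (a := e.1) ?_)
      rw [rank_eq_of_not_covered he1 hx, rank_eq_of_not_covered he1 hy]

theorem card_complete : (complete (irvingMatching c p (n - 1))).card = n := by
  have hM := isMatching_irvingMatching (c := c) (p := p) (i := n - 1)
  have himg : (complete (irvingMatching c p (n - 1))).image Prod.fst = Finset.univ := by
    refine Finset.eq_univ_iff_forall.2 fun a => covered_inl.1 ?_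
    by_cases ha : Covered (irvingMatching c p (n - 1)) (.inl a)
    · exact ha.mono fun e he => mem_complete.2 (Or.inl he)
    · obtain ⟨h, hh⟩ := hM.exists_not_covered_house ha
      exact ⟨h, mem_complete.2 (Or.inr ⟨ha, hh⟩)⟩
  rw [← isMatching_complete.card_image_fst, himg, Finset.card_univ, Fintype.card_fin]

theorem isRankMaximal_complete (c : Choices n) (p : Profile n) :
    IsRankMaximal p (complete (irvingMatching c p (n - 1))) := by
  rw [isRankMaximal_iff_good c]
  refine ⟨isMatching_complete, ?_⟩
  rcases Nat.eq_zero_or_pos n with rfl | hn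
  · exact fun j h1 h2 => by omega
  have hG : Good c p (n - 1) (complete (irvingMatching c p (n - 1))) := by
    intro j h1 hj
    have : upTo p j (complete (irvingMatching c p (n - 1))) =
        upTo p j (irvingMatching c p (n - 1)) := by
      ext e
      rw [mem_upTo, mem_upTo, mem_complete]
      constructor
      · rintro ⟨he | he, hr⟩
        · exact ⟨he, hr⟩
        · rw [rank_eq_of_not_covered he.1 he.2] at hr
          omega
      · exact fun h => ⟨Or.inl h.1, h.2⟩
    rw [this]
    exact good_irvingMatching c p (n - 1) j h1 hj
  have hI := good_irvingMatching c p (n - 1 + 1)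
  have h := hG.succ isMatching_complete hI ?_
  · rwa [Nat.sub_add_cancel hn] at h
  · rw [Nat.sub_add_cancel hn, upTo_top, upTo_top, card_complete]
    exact isMatching_irvingMatching.card_le

/-- The number of agents that are queried in the rounds `1, …, n - 1`, each counted once for every
round in which it is queried. -/
noncomputable def totalQueries (c : Choices n) (p : Profile n) : ℕ := by
  classical exact ∑ i ∈ Finset.range (n - 1), {a | Alive c p i (.inl a)}.toFinset.card

theorem elicitationAlgorithm_eq (hn : n ≠ 2) (c : Choices n) : elicitationAlgorithm n c =
    (rounds c (n - 1)).bind (fun s => Online.ret (complete s.M)) := by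
  unfold elicitationAlgorithm
  split
  · exact absurd rfl hn
  · rfl

theorem run_elicitationAlgorithm (hn : n ≠ 2) (c : Choices n) (p : Profile n) :
    ∃ hist, (elicitationAlgorithm n c).run p [] =
      some (complete (irvingMatching c p (n - 1)), hist) ∧ hist.length = totalQueries c p := by
  obtain ⟨s, hist, hrun, hs, hlen⟩ := exists_run_rounds c p (n - 1) (by omega)
  refine ⟨hist, ?_, hlen⟩
  rw [elicitationAlgorithm_eq hn, Online.run_bind, hrun, ← hs.eq_M]
  rfl

/-- For two agents, the first choice of one agent suffices: a matching could dominate the returned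
one only by giving both agents their first choices, but then it is the returned one. -/
theorem isRankMaximal_two (p : Profile 2) :
    IsRankMaximal p {(0, p 0 0), (1, Equiv.swap 0 1 (p 0 0))} := by
  have hne : Equiv.swap 0 1 (p 0 0) ≠ p 0 0 := by
    rw [Ne, Equiv.swap_apply_eq_iff]
    generalize p 0 0 = x
    fin_cases x <;> decide
  set M : Edges 2 := {(0, p 0 0), (1, Equiv.swap 0 1 (p 0 0))} with hMdef
  have hM : IsMatching M := by
    intro e he f hf hef
    simp only [hMdef, Finset.mem_insert, Finset.mem_singleton] at he hf
    rcases he with rfl | rfl <;> rcases hf with rfl | rfl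
    · rfl
    · simp [hne.symm] at hef
    · simp [hne] at hef
    · rfl
  have hcard : M.card = 2 := by simp [hMdef]
  refine ⟨hM, fun N hN hdom => ?_⟩
  obtain ⟨l, h1, h2, -, hlt⟩ := (rankDominates_iff hM hN).1 hdom
  have hrank : ∀ a h : Fin 2, rank p a h ≤ 1 ↔ h = p a 0 := by
    intro a h
    rw [← Equiv.symm_apply_eq, Fin.ext_iff, rank]
    simp
  have hN2 := hN.card_le
  rcases h2.eq_or_lt with rfl | h2
  · rw [upTo_top, upTo_top] at hlt
    omega
  obtain rfl : l = 1 := by omega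
  have hN1 := Finset.card_le_card (upTo_subset (p := p) (i := 1) (M := N))
  have h0 : (0, p 0 0) ∈ upTo p 1 M := mem_upTo.2 ⟨by simp [hMdef], (hrank _ _).2 rfl⟩
  have hM1 := Finset.card_pos.2 ⟨_, h0⟩
  -- The other matching gives both agents their first choices, hence these are distinct.
  have heq : upTo p 1 N = N := Finset.eq_of_subset_of_card_le upTo_subset (by omega)
  have himg : N.image Prod.fst = Finset.univ := by
    rw [← Finset.card_eq_iff_eq_univ, hN.card_image_fst, Fintype.card_fin]
    omega
  have hmem : ∀ a, (a, p a 0) ∈ N := by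
    intro a
    obtain ⟨e, he, rfl⟩ := Finset.mem_image.1 (himg ▸ Finset.mem_univ a)
    rw [← (hrank _ _).1 (mem_upTo.1 (heq.symm ▸ he)).2]
    exact he
  have hdist : p 1 0 ≠ p 0 0 := fun h => by
    have := hN.agent_unique (hmem 0) (h ▸ hmem 1)
    exact absurd this (by decide)
  have hsw : Equiv.swap 0 1 (p 0 0) = p 1 0 := by
    generalize p 0 0 = x at *
    generalize p 1 0 = y at *
    fin_cases x <;> fin_cases y <;> simp_all
  have hMM : upTo p 1 M = M := by
    refine Finset.filter_true_of_mem fun e he => ?_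
    simp only [hMdef, Finset.mem_insert, Finset.mem_singleton] at he
    rcases he with rfl | rfl
    · exact (hrank _ _).2 rfl
    · exact (hrank _ _).2 hsw
  rw [hMM] at hlt
  omega

theorem run_elicitationAlgorithm_two (c : Choices 2) (p : Profile 2) :
    (elicitationAlgorithm 2 c).run p [] =
      some ({(0, p 0 0), (1, Equiv.swap 0 1 (p 0 0))}, [(0, p 0 0)]) := rfl

/-- If an algorithm returns a rank-maximal matching on every profile, then this matching is
necessarily rank-maximal: on a profile with the same answers, the run would be the same. -/
theorem elicitsNRM_of_isRankMaximal (alg : Online n (Edges n))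
    (h : ∀ p, ∃ M hist, alg.run p [] = some (M, hist) ∧ IsRankMaximal p M) : ElicitsNRM alg := by
  intro p
  obtain ⟨M, hist, hrun, -⟩ := h p
  refine ⟨M, hist, hrun, fun p' hp' => ?_⟩
  obtain ⟨M', hist', hrun', hM'⟩ := h p'
  rw [alg.run_eq_of_consistent hrun hp'] at hrun'
  simp only [Option.some.injEq, Prod.mk.injEq] at hrun'
  rwa [hrun'.1]

theorem elicitsNRM (c : Choices n) : ElicitsNRM (elicitationAlgorithm n c) := by
  refine elicitsNRM_of_isRankMaximal _ fun p => ?_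
  by_cases hn : n = 2
  · subst hn
    exact ⟨_, _, run_elicitationAlgorithm_two c p, isRankMaximal_two p⟩
  · obtain ⟨hist, hrun, -⟩ := run_elicitationAlgorithm hn c p
    exact ⟨_, hist, hrun, isRankMaximal_complete c p⟩

end Correctness

/-! ### Changing the unknown part of a profile -/

section Locality

variable {n : ℕ} {c : Choices n} {p p' p'' : Profile n} {M N : Edges n} {i j : ℕ}

/-- Both profiles have the same houses at the first `i` places of every list. -/
def AgreeUpTo (i : ℕ) (p p' : Profile n) : Prop :=
  ∀ (a k : Fin n), (k : ℕ) < i → p a k = p' a k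

theorem AgreeUpTo.symm (h : AgreeUpTo i p p') : AgreeUpTo i p' p :=
  fun a k hk => (h a k hk).symm

theorem AgreeUpTo.trans (h : AgreeUpTo i p p') (h' : AgreeUpTo i p' p'') : AgreeUpTo i p p'' :=
  fun a k hk => (h a k hk).trans (h' a k hk)

theorem AgreeUpTo.rank_eq (h : AgreeUpTo i p p') {a x : Fin n} (hx : rank p a x ≤ i) :
    rank p' a x = rank p a x := by
  have := h a ((p a).symm x) hx
  rw [Equiv.apply_symm_apply] at this
  rw [rank, rank, (Equiv.symm_apply_eq _).2 this]

theorem AgreeUpTo.rank_le_iff (h : AgreeUpTo i p p') (hj : j ≤ i) {a x : Fin n} :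
    rank p a x ≤ j ↔ rank p' a x ≤ j :=
  ⟨fun hx => (h.rank_eq (hx.trans hj)).trans_le hx,
    fun hx => (h.symm.rank_eq (hx.trans hj)).trans_le hx⟩

theorem AgreeUpTo.rankGraph_eq (h : AgreeUpTo i p p') (hj : j ≤ i) (D : Edges n) :
    rankGraph p j D = rankGraph p' j D :=
  Finset.filter_congr fun _ _ => and_congr_left' (h.rank_le_iff hj)

/-- The first `i` rounds depend only on the first `i` places of the lists. -/
theorem AgreeUpTo.irving_eq (h : AgreeUpTo i p p') (hj : j ≤ i) :
    irving c p j = irving c p' j := by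
  induction j with
  | zero => rfl
  | succ j ih =>
    have hlt : ∀ e : Fin n × Fin n, j + 1 < rank p e.1 e.2 ↔ j + 1 < rank p' e.1 e.2 := fun e => by
      rw [← not_le, ← not_le, h.rank_le_iff hj]
    refine Prod.ext (Finset.ext fun e => ?_) ?_
    · simp only [irving, Finset.mem_union, Finset.mem_filter, ih (by omega), h.rankGraph_eq hj, hlt]
    · simp only [irving, ih (by omega), h.rankGraph_eq hj]

theorem AgreeUpTo.irvingGraph_eq (h : AgreeUpTo i p p') (hj : j ≤ i) :
    irvingGraph c p j = irvingGraph c p' j := by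
  rw [irvingGraph, irvingGraph, h.irving_eq (by omega : j - 1 ≤ i), h.rankGraph_eq hj]

theorem AgreeUpTo.alive_iff (h : AgreeUpTo i p p') (hj : j ≤ i) {v : Fin n ⊕ Fin n} :
    Alive c p j v ↔ Alive c p' j v := by
  refine forall_congr' fun k => forall_congr' fun _ => forall_congr' fun hk => ?_
  rw [Live, Live, irvingMatching, irvingMatching, h.irving_eq (hk.trans hj),
    h.irvingGraph_eq (hk.trans hj)]

/-- The profile in which `a` exchanges the places of the houses `g` and `h`. -/
def exchange (p : Profile n) (a g h : Fin n) : Profile n :=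
  Function.update p a ((p a).trans (Equiv.swap g h))

theorem rank_exchange_self (p : Profile n) (a g h x : Fin n) :
    rank (exchange p a g h) a x = rank p a (Equiv.swap g h x) := by
  simp [rank, exchange]

theorem rank_exchange_of_ne (p : Profile n) {a b : Fin n} (g h x : Fin n) (hab : b ≠ a) :
    rank (exchange p a g h) b x = rank p b x := by
  simp [rank, exchange, hab]

theorem rank_exchange_left (p : Profile n) (a g h : Fin n) :
    rank (exchange p a g h) a g = rank p a h := by
  rw [rank_exchange_self, Equiv.swap_apply_left]

theorem rank_exchange_right (p : Profile n) (a g h : Fin n) :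
    rank (exchange p a g h) a h = rank p a g := by
  rw [rank_exchange_self, Equiv.swap_apply_right]

theorem exchange_apply {a g h : Fin n} {b k : Fin n}
    (hg : b = a → (k : ℕ) + 1 < rank p a g) (hh : b = a → (k : ℕ) + 1 < rank p a h) :
    exchange p a g h b k = p b k := by
  by_cases hab : b = a
  · subst hab
    have hr : rank p b (p b k) = k + 1 := by simp [rank]
    have h1 : p b k ≠ g := fun heq => by have := hg rfl; rw [← heq, hr] at this; omega
    have h2 : p b k ≠ h := fun heq => by have := hh rfl; rw [← heq, hr] at this; omega
    simp [exchange, Equiv.swap_apply_of_ne_of_ne h1 h2]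
  · simp [exchange, hab]

theorem agreeUpTo_exchange {a g h : Fin n} (hg : i < rank p a g) (hh : i < rank p a h) :
    AgreeUpTo i p (exchange p a g h) :=
  fun _ k hk => (exchange_apply (fun _ => by omega) fun _ => by omega).symm

theorem exists_rank_eq (p : Profile n) (a : Fin n) (h1 : 1 ≤ i) (hi : i ≤ n) :
    ∃ g, rank p a g = i := by
  refine ⟨p a ⟨i - 1, by omega⟩, ?_⟩
  simp [rank]
  omega

theorem Consistent.of_agree {hist : History n} (hc : Consistent p hist)
    (h : ∀ (a k : Fin n), (k : ℕ) < numAsked hist a → p' a k = p a k) : Consistent p' hist := by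
  rintro l₁ l₂ a x rfl
  have hx := hc l₁ l₂ a x rfl
  unfold nextBest at hx ⊢
  split_ifs at hx ⊢ with hk
  · rw [h a ⟨_, hk⟩ (by rw [numAsked_append, numAsked_cons, if_pos rfl]; simp only; omega)]
    exact hx

/-- Places that have not been revealed may be exchanged. -/
theorem Consistent.exchange {hist : History n} (hc : Consistent p hist) {a g h : Fin n}
    (hg : numAsked hist a < rank p a g) (hh : numAsked hist a < rank p a h) :
    Consistent (exchange p a g h) hist :=
  hc.of_agree fun b k hk => exchange_apply (by rintro rfl; omega) (by rintro rfl; omega)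

end Locality

/-! ### Necessarily rank-maximal matchings require many answers -/

section LowerBound

variable {n : ℕ} {c : Choices n} {p p' : Profile n} {E E' M N : Edges n} {i j : ℕ}

theorem IsMaximumMatching.covered_of_inE {v w : Fin n ⊕ Fin n} (hM : IsMaximumMatching E M)
    (hv : InE E M v) (hvw : Joined E v w) : Covered M w :=
  not_not.1 fun hw => hM.not_inO_of_inE (inE_of_not_covered hw) (hv.inO_of_joined hM.2.1 hvw)

theorem InE.exists_not_covered_house {v : Fin n ⊕ Fin n} (hM : IsMatching M) (hv : InE E M v) :
    ∃ h, ¬ Covered M (.inr h) := by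
  obtain ⟨r, hr, -⟩ := altReach_iff_rootReach.1 hv
  rcases r with a | h
  · exact hM.exists_not_covered_house hr
  · exact ⟨h, hr⟩

theorem mem_irvingGraph_succ_of_live {e : Fin n × Fin n} (hj : 1 ≤ j)
    (he : e ∈ irvingGraph c p j) (hL : Live c p j (.inl e.1) ∨ Live c p j (.inr e.2)) :
    e ∈ irvingGraph c p (j + 1) := by
  obtain ⟨h1, h2, h3⟩ := (mem_irvingGraph hj).1 he
  refine (mem_irvingGraph (by omega)).2 ⟨by omega, h2, fun k hk1 hk2 => ?_⟩
  rcases Nat.lt_or_ge k j with hk | hk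
  · exact h3 k hk1 hk
  · rw [show k = j by omega]
    exact Live.not_mem_forbiddenEdges hj hL

/-- An alternating walk from an uncovered vertex remains an alternating walk in the next round. -/
theorem Good.rootReach_succ (hN : Good c p j N) (hj : 1 ≤ j) {r v : Fin n ⊕ Fin n} {b : Bool}
    (hr : ¬ Covered (upTo p j N) r) (h : RootReach (irvingGraph c p j) (upTo p j N) r b v) :
    RootReach (irvingGraph c p (j + 1)) (upTo p (j + 1) N) r b v := by
  induction h with
  | start => exact .start
  | @unmatchedStep v w hv hw ih =>
    refine ih.unmatchedStep ?_
    have hL : Live c p j v := (hN.live_iff hj le_rfl).2 (altReach_iff_rootReach.2 ⟨r, hr, hv⟩)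
    have key : ∀ e ∈ irvingGraph c p j \ upTo p j N,
        (Live c p j (.inl e.1) ∨ Live c p j (.inr e.2)) →
        e ∈ irvingGraph c p (j + 1) \ upTo p (j + 1) N := by
      intro e he hLe
      rw [Finset.mem_sdiff] at he ⊢
      exact ⟨mem_irvingGraph_succ_of_live hj he.1 hLe, fun h => he.2
        (mem_upTo.2 ⟨(mem_upTo.1 h).1, rank_le_of_mem_irvingGraph he.1⟩)⟩
    rcases v with a | x <;> rcases w with d | y
    · exact hw.elim
    · exact key _ hw (Or.inl hL)
    · exact key _ hw (Or.inr hL)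
    · exact hw.elim
  | matchedStep _ hw ih => exact ih.matchedStep (hw.mono (upTo_mono (Nat.le_succ j)))

/-- If edges of `a` are removed, then every alternating walk from an agent survives, or at least
one that leads to `a` does. -/
theorem RootReach.of_remove_agent {a : Fin n} {r v : Fin n ⊕ Fin n} {b : Bool}
    (h : RootReach E M r b v) (hr : r.isLeft = true) (hE : ∀ e ∈ E, e ∈ E' ∨ e.1 = a) :
    RootReach E' M r b v ∨ RootReach E' M r false (.inl a) := by
  induction h with
  | start => exact Or.inl .start
  | @unmatchedStep v w hv hw ih =>
    rcases ih with ih | ih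
    · have hl := hv.isLeft
      rcases v with x | x
      · rcases w with y | y
        · exact hw.elim
        · obtain ⟨hw1, hw2⟩ := Finset.mem_sdiff.1 hw
          rcases hE _ hw1 with hw' | rfl
          · exact Or.inl (ih.unmatchedStep (w := .inr y) (Finset.mem_sdiff.2 ⟨hw', hw2⟩))
          · exact Or.inr ih
      · simp [hr] at hl
    · exact Or.inr ih
  | matchedStep _ hw ih => exact ih.imp (fun ih => ih.matchedStep hw) id

theorem IsNecessarilyRankMaximal.good {hist : History n} (hM : IsNecessarilyRankMaximal hist M)
    (hc : Consistent p hist) : Good c p n M :=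
  ((isRankMaximal_iff_good c).1 (hM p hc)).2

theorem Good.covered (hM : IsMatching M) (hG : Good c p n M) (v : Fin n ⊕ Fin n) :
    Covered M v := by
  have key : ∀ a h, ¬ Covered M (.inl a) → ¬ Covered M (.inr h) → False := by
    intro a h ha hh
    rw [← upTo_top (p := p) (M := M)] at ha hh
    have := (hG.alive_of_not_covered le_rfl ha).lt_rank (hG.alive_of_not_covered le_rfl hh)
    have := rank_le p a h
    omega
  by_contra hv
  rcases v with a | h
  · obtain ⟨h, hh⟩ := hM.exists_not_covered_house hv
    exact key a h hv hh
  · obtain ⟨a, ha⟩ := hM.exists_not_covered_agent hv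
    exact key a h ha hv

theorem not_covered_upTo_of_lt {a h : Fin n} (hM : IsMatching M) (hah : (a, h) ∈ M)
    (hj : j < rank p a h) :
    ¬ Covered (upTo p j M) (.inl a) ∧ ¬ Covered (upTo p j M) (.inr h) := by
  constructor
  · rintro ⟨x, hx⟩
    obtain ⟨hx, hr⟩ := mem_upTo.1 hx
    rw [hM.house_unique hx hah] at hr
    exact absurd hr (not_le.2 hj)
  · rintro ⟨b, hb⟩
    obtain ⟨hb, hr⟩ := mem_upTo.1 hb
    rw [hM.agent_unique hb hah] at hr
    exact absurd hr (not_le.2 hj)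

variable {hist : History n}

/-- If the house `h` of `a` has not been revealed to be on the list of `a`, then the pairs
whose rank is at most that of `(a, h)` cover everything: otherwise, `a` might prefer an uncovered house
to `h`. -/
theorem covered_of_unknown (hM : IsNecessarilyRankMaximal hist M) (hc : Consistent p hist)
    (c : Choices n) {a h : Fin n} (hah : (a, h) ∈ M) (hk : numAsked hist a < rank p a h)
    (x : Fin n) : Covered (upTo p (rank p a h) M) (.inr x) := by
  by_contra hx
  have hmat := (hM p hc).1
  have hG : Good c p n M := hM.good hc
  have h1 := one_le_rank p a h
  have hn := rank_le p a h
  set r := rank p a h with hr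
  have hxh : x ≠ h := by
    rintro rfl
    exact hx ⟨a, mem_upTo.2 ⟨hah, le_rfl⟩⟩
  have hxa : Alive c p (r - 1) (.inr x) := (hG.alive_of_not_covered hn hx).mono (by omega)
  have haa : Alive c p (r - 1) (.inl a) :=
    hG.alive_of_not_covered (by omega) (not_covered_upTo_of_lt hmat hah (by omega)).1
  have hrx : r < rank p a x := by
    have := haa.lt_rank hxa
    have : rank p a x ≠ rank p a h := fun heq => hxh (rank_inj heq)
    omega
  have hag : AgreeUpTo (r - 1) p (exchange p a h x) := agreeUpTo_exchange (by omega) (by omega)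
  have hG' : Good c (exchange p a h x) n M := hM.good (hc.exchange hk (by omega))
  have hrx' : rank (exchange p a h x) a x = r := rank_exchange_right p a h x
  have hrh' : rank (exchange p a h x) a h = rank p a x := rank_exchange_left p a h x
  have hmem : (a, x) ∈ irvingGraph c (exchange p a h x) r := by
    have := mem_irvingGraph_succ_iff (c := c) (p := exchange p a h x) (i := r - 1) (e := (a, x))
    rw [Nat.sub_add_cancel h1] at this
    exact this.2 (Or.inr ⟨hrx', (hag.alive_iff le_rfl).1 haa, (hag.alive_iff le_rfl).1 hxa⟩)
  have hua : ¬ Covered (upTo (exchange p a h x) r M) (.inl a) :=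
    (not_covered_upTo_of_lt hmat hah (by omega)).1
  obtain ⟨b, hb⟩ := (hG' r h1 hn).covered_of_inE (inE_of_not_covered hua) (w := .inr x) hmem
  have hba : b ≠ a := by
    rintro rfl
    exact hua ⟨x, hb⟩
  obtain ⟨hbM, hbr⟩ := mem_upTo.1 hb
  exact hx ⟨b, mem_upTo.2 ⟨hbM, by rwa [rank_exchange_of_ne p h x x hba] at hbr⟩⟩

/-- An agent whose house is known has to be queried in all rounds in which it stays in `𝓔`:
otherwise, its next house might be an uncovered one, which allows an augmentation. -/
theorem le_numAsked_of_alive (hM : IsNecessarilyRankMaximal hist M) (hc : Consistent p hist)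
    {a h : Fin n} (hah : (a, h) ∈ M) (hk : rank p a h ≤ numAsked hist a) (h1 : 1 ≤ i)
    (hi : i ≤ n) (ha : Alive c p i (.inl a)) : i ≤ numAsked hist a := by
  by_contra hlt
  rw [not_le] at hlt
  have hmat := (hM p hc).1
  have hG : Good c p n M := hM.good hc
  have haE := (hG.live_iff h1 hi).1 (ha i h1 le_rfl)
  obtain ⟨x, hx⟩ := haE.exists_not_covered_house (hmat.subset upTo_subset)
  have hxa := hG.alive_of_not_covered hi hx
  have hrx := ha.lt_rank hxa
  obtain ⟨g, hg⟩ := exists_rank_eq p a h1 hi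
  set p' := exchange p a g x with hp'
  have hag : AgreeUpTo (i - 1) p p' := agreeUpTo_exchange (by omega) (by omega)
  have hG' : Good c p' n M := hM.good (hc.exchange (by omega) (by omega))
  have hup : upTo p' i M = upTo p i M := by
    refine Finset.filter_congr fun e he => ?_
    by_cases hea : e.1 = a
    · have heh : e.2 = h := hmat.house_unique (a := a) (by rw [← hea]; exact he) hah
      rw [hea, heh, hp', rank_exchange_self, Equiv.swap_apply_of_ne_of_ne]
      · rintro rfl; omega
      · rintro rfl; omega
    · rw [hp', rank_exchange_of_ne p g x _ hea]
  have hgraph : ∀ e, e ∈ irvingGraph c p' i ↔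
      (rank p' e.1 e.2 ≤ i - 1 ∧ e ∉ (irving c p' (i - 1)).1) ∨
      (rank p' e.1 e.2 = i ∧ Alive c p' (i - 1) (.inl e.1) ∧ Alive c p' (i - 1) (.inr e.2)) := by
    intro e
    have := mem_irvingGraph_succ_iff (c := c) (p := p') (i := i - 1) (e := e)
    rwa [Nat.sub_add_cancel h1] at this
  have hsub : ∀ e ∈ irvingGraph c p i, e ∈ irvingGraph c p' i ∨ e.1 = a := by
    intro e he
    by_cases hea : e.1 = a
    · exact Or.inr hea
    rw [← Nat.sub_add_cancel h1, mem_irvingGraph_succ_iff, Nat.sub_add_cancel h1] at he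
    rw [hgraph, hp', rank_exchange_of_ne p g x _ hea, ← hp', ← hag.irving_eq le_rfl,
      ← hag.alive_iff le_rfl, ← hag.alive_iff le_rfl]
    exact Or.inl he
  obtain ⟨r, hr, hwalk⟩ := altReach_iff_rootReach.1 haE
  have hrl : r.isLeft = true := by simpa using hwalk.isLeft.symm
  have haE' : InE (irvingGraph c p' i) (upTo p' i M) (.inl a) := by
    rw [hup]
    exact altReach_iff_rootReach.2 ⟨r, hr, (hwalk.of_remove_agent hrl hsub).elim id id⟩
  have hmem : (a, x) ∈ irvingGraph c p' i := (hgraph _).2 (Or.inr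
    ⟨(rank_exchange_right p a g x).trans hg, (hag.alive_iff le_rfl).1 (ha.mono (by omega)),
      (hag.alive_iff le_rfl).1 (hxa.mono (by omega))⟩)
  have := (hG' i h1 hi).covered_of_inE haE' (w := .inr x) hmem
  rw [hup] at this
  exact hx this

/-- If the house `h` of `a` has not been revealed to be on the list of `a`, then every other agent
`b` has to be queried as often as the elicitation algorithm does: otherwise, `h` might be the last
house of `a` and the next one of `b`. -/
theorem le_numAsked_of_unknown (hM : IsNecessarilyRankMaximal hist M) (hc : Consistent p hist)
    {a h : Fin n} (hah : (a, h) ∈ M) (hk : numAsked hist a < rank p a h) {b : Fin n}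
    (hba : b ≠ a) (h1 : 1 ≤ i) (hi : i < n) (hb : Alive c p (i - 1) (.inl b)) :
    i ≤ numAsked hist b := by
  by_contra hlt
  rw [not_le] at hlt
  have hmat := (hM p hc).1
  have hG : Good c p n M := hM.good hc
  have hrn := rank_le p a h
  have hir : i ≤ rank p a h := by
    by_contra hri
    have hL := hb (rank p a h) (one_le_rank p a h) (by omega)
    obtain ⟨x, hx⟩ := ((hG.live_iff (one_le_rank p a h) hrn).1 hL).exists_not_covered_house
      (hmat.subset upTo_subset)
    exact hx (covered_of_unknown hM hc c hah hk x)
  have hhA : Alive c p (i - 1) (.inr h) :=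
    hG.alive_of_not_covered (by omega) (not_covered_upTo_of_lt hmat hah (by omega)).2
  have hbh := hb.lt_rank hhA
  -- In `p₂`, the house `h` is the last one of `a` and the `i`-th one of `b`.
  obtain ⟨l, hl⟩ := exists_rank_eq p a (i := n) (by omega) le_rfl
  set p₁ := exchange p a h l with hp₁
  have hc₁ : Consistent p₁ hist := hc.exchange hk (by omega)
  have hag₁ : AgreeUpTo (i - 1) p p₁ := agreeUpTo_exchange (by omega) (by omega)
  obtain ⟨g, hg⟩ := exists_rank_eq p₁ b h1 hi.le
  have hbh₁ : rank p₁ b h = rank p b h := rank_exchange_of_ne p h l h hba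
  set p₂ := exchange p₁ b g h with hp₂
  have hc₂ : Consistent p₂ hist := hc₁.exchange (by omega) (by omega)
  have hag : AgreeUpTo (i - 1) p p₂ := hag₁.trans (agreeUpTo_exchange (by omega) (by omega))
  have hah₂ : rank p₂ a h = n := by
    rw [hp₂, rank_exchange_of_ne p₁ g h h hba.symm, hp₁, rank_exchange_left, hl]
  have hbh₂ : rank p₂ b h = i := by rw [hp₂, rank_exchange_right, hg]
  have hG₂ : Good c p₂ n M := hM.good hc₂
  have hun : ∀ j < n, ¬ Covered (upTo p₂ j M) (.inl a) ∧ ¬ Covered (upTo p₂ j M) (.inr h) :=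
    fun j hj => not_covered_upTo_of_lt hmat hah (by omega)
  have hbA₂ := (hag.alive_iff le_rfl).1 hb
  have hmem : (b, h) ∈ irvingGraph c p₂ i := by
    have := mem_irvingGraph_succ_iff (c := c) (p := p₂) (i := i - 1) (e := (b, h))
    rw [Nat.sub_add_cancel h1] at this
    exact this.2 (Or.inr ⟨hbh₂, hbA₂, (hag.alive_iff le_rfl).1 hhA⟩)
  have hmax := hG₂ i h1 hi.le
  have hbE : ¬ InE (irvingGraph c p₂ i) (upTo p₂ i M) (.inl b) := fun hE =>
    (hun i hi).2 (hmax.covered_of_inE hE (w := .inr h) hmem)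
  obtain ⟨y, hy⟩ : Covered (upTo p₂ i M) (.inl b) :=
    not_not.1 fun hcov => hbE (inE_of_not_covered hcov)
  obtain ⟨hyM, hyr⟩ := mem_upTo.1 hy
  have hyh : y ≠ h := by
    rintro rfl
    exact hba (hmat.agent_unique hyM hah)
  have hyi : rank p₂ b y ≠ i := fun heq => hyh (rank_inj (heq.trans hbh₂.symm))
  have hyr' : rank p₂ b y ≤ i := hyr
  have hy1 := one_le_rank p₂ b y
  -- The agent `b` is reached from an agent `x` that is uncovered before round `i`.
  obtain ⟨r, hr, hwalk⟩ := altReach_iff_rootReach.1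
    ((hG₂.live_iff (j := i - 1) (by omega) (by omega)).1 (hbA₂ (i - 1) (by omega) le_rfl))
  have hwalk' := (hG₂.mono (by omega)).rootReach_succ (by omega) hr hwalk
  rw [Nat.sub_add_cancel h1] at hwalk'
  have hrl : r.isLeft = true := by simpa using hwalk.isLeft.symm
  obtain ⟨x, rfl⟩ := Sum.isLeft_iff.1 hrl
  obtain ⟨z, hz⟩ : Covered (upTo p₂ i M) (.inl x) :=
    not_not.1 fun hcov => hbE (altReach_iff_rootReach.2 ⟨_, hcov, hwalk'⟩)
  have hzM := (mem_upTo.1 hz).1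
  -- Reversing the walk shows that the new house `z` of `x` is reached from `h`, and it stays so.
  have hstart : RootReach (irvingGraph c p₂ i) (upTo p₂ i M) (.inr h) true (.inl b) :=
    RootReach.start.unmatchedStep (w := .inl b) (Finset.mem_sdiff.2
      ⟨hmem, fun hbM => hyh (hmat.house_unique hyM (mem_upTo.1 hbM).1)⟩)
  have hz₀ : RootReach (irvingGraph c p₂ i) (upTo p₂ i M) (.inr h) false (.inr z) :=
    (hwalk'.reverse hstart).matchedStep (w := .inr z) hz
  have hzreach : ∀ j, i ≤ j → j < n →
      RootReach (irvingGraph c p₂ j) (upTo p₂ j M) (.inr h) false (.inr z) := by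
    intro j hij
    induction j, hij using Nat.le_induction with
    | base => exact fun _ => hz₀
    | succ j hij ih =>
      exact fun hj => (hG₂.mono (by omega)).rootReach_succ (by omega) (hun j (by omega)).2
        (ih (by omega))
  have hzun : ¬ Covered (upTo p₂ (i - 1) M) (.inr z) := by
    rintro ⟨x', hx'⟩
    rw [hmat.agent_unique (mem_upTo.1 hx').1 hzM] at hx'
    exact hr ⟨z, hx'⟩
  have hzA : Alive c p₂ (n - 1) (.inr z) := by
    intro j hj1 hj
    rcases Nat.lt_or_ge j i with hji | hji
    · exact hG₂.alive_of_not_covered (by omega) hzun j hj1 (by omega)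
    · exact (hG₂.live_iff hj1 (by omega)).2
        (altReach_iff_rootReach.2 ⟨_, (hun j (by omega)).2, hzreach j hji (by omega)⟩)
  have haA : Alive c p₂ (n - 1) (.inl a) :=
    hG₂.alive_of_not_covered (by omega) (hun (n - 1) (by omega)).1
  have haz := haA.lt_rank hzA
  have haz' := rank_le p₂ a z
  have : z = h := rank_inj (p := p₂) (a := a) (by omega)
  exact (hun i hi).2 ⟨x, this ▸ hz⟩

/-- An agent with first choice `h` stays in `𝓔` only together with the agent that gets `h`. -/
theorem Alive.of_same_first (hG : Good c p n M) {a b h : Fin n} (hj : j ≤ n)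
    (ha : Alive c p j (.inl a)) (hah : rank p a h = 1) (hbM : (b, h) ∈ M)
    (hbh : rank p b h = 1) : Alive c p j (.inl b) := by
  intro k hk1 hkj
  have hmem : (a, h) ∈ irvingGraph c p k := (mem_irvingGraph hk1).2
    ⟨hah.trans_le hk1, fun m hm1 hm2 => by simp only [hah] at hm2; omega,
      fun m hm1 hm2 => Live.not_mem_forbiddenEdges (by simp only [hah] at hm1; omega)
        (Or.inl (ha m (by simp only [hah] at hm1; omega) (by omega)))⟩
  have hE := (hG.live_iff hk1 (hkj.trans hj)).1 (ha k hk1 hkj)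
  have hmax := hG k hk1 (hkj.trans hj)
  refine (hG.live_iff hk1 (hkj.trans hj)).2 ?_
  exact (hE.inO_of_joined hmax.2.1 (w := .inr h) hmem).inE_of_joined (w := .inl b)
    (mem_upTo.2 ⟨hbM, hbh.trans_le hk1⟩)

theorem exists_same_first (hG : Good c p n M) {a : Fin n}
    (ha : ¬ Covered (upTo p 1 M) (.inl a)) :
    ∃ b h, b ≠ a ∧ (b, h) ∈ M ∧ rank p a h = 1 ∧ rank p b h = 1 := by
  have hn : 1 ≤ n := Nat.one_le_iff_ne_zero.2 fun h0 => by subst h0; exact a.elim0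
  obtain ⟨h, hh⟩ := exists_rank_eq p a le_rfl hn
  have hmem : (a, h) ∈ irvingGraph c p 1 := (mem_irvingGraph le_rfl).2
    ⟨hh.le, fun m hm1 hm2 => by simp only [hh] at hm2; omega,
      fun m hm1 hm2 => by simp only [hh] at hm1; omega⟩
  obtain ⟨b, hb⟩ := (hG 1 le_rfl hn).covered_of_inE (inE_of_not_covered ha) (w := .inr h) hmem
  have hbr := (mem_upTo.1 hb).2
  refine ⟨b, h, ?_, (mem_upTo.1 hb).1, hh, le_antisymm hbr (one_le_rank p b h)⟩
  rintro rfl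
  exact ha ⟨h, hb⟩

end LowerBound

/-! ### The competitive ratio -/

section Competitive

variable {n : ℕ} {c : Choices n} {p : Profile n} {M : Edges n} {hist : History n} {i : ℕ}

open Classical in
/-- The number of queries to `a` in the rounds `1, …, n - 1` of the elicitation algorithm. -/
noncomputable def queryCount (c : Choices n) (p : Profile n) (a : Fin n) : ℕ :=
  ((Finset.range (n - 1)).filter (fun i => Alive c p i (.inl a))).card

theorem totalQueries_eq_sum (c : Choices n) (p : Profile n) :
    totalQueries c p = ∑ a, queryCount c p a := by
  classical
  unfold totalQueries queryCount
  simp only [Finset.card_filter, Set.toFinset_ofPred]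
  exact Finset.sum_comm

theorem queryCount_le (a : Fin n) : queryCount c p a ≤ n - 1 := by
  classical
  exact (Finset.card_filter_le _ _).trans_eq (Finset.card_range _)

theorem lt_queryCount_iff {a : Fin n} :
    i < queryCount c p a ↔ i < n - 1 ∧ Alive c p i (.inl a) := by
  classical
  constructor
  · intro h
    by_contra hno
    have hsub : (Finset.range (n - 1)).filter (fun i => Alive c p i (.inl a)) ⊆
        Finset.range i := by
      intro j hj
      rw [Finset.mem_filter, Finset.mem_range] at hj
      rw [Finset.mem_range]
      by_contra hij
      exact hno ⟨by omega, hj.2.mono (by omega)⟩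
    have := Finset.card_le_card hsub
    rw [Finset.card_range] at this
    unfold queryCount at h
    omega
  · rintro ⟨hi, hA⟩
    have hsub : Finset.range (i + 1) ⊆
        (Finset.range (n - 1)).filter (fun i => Alive c p i (.inl a)) := by
      intro j hj
      rw [Finset.mem_range] at hj
      exact Finset.mem_filter.2 ⟨Finset.mem_range.2 (by omega), hA.mono (by omega)⟩
    have := Finset.card_le_card hsub
    rw [Finset.card_range] at this
    unfold queryCount
    omega

theorem one_le_queryCount (hn : 2 ≤ n) (a : Fin n) : 1 ≤ queryCount c p a :=
  lt_queryCount_iff.2 ⟨by omega, alive_zero⟩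

theorem length_eq_sum_numAsked (hist : History n) : hist.length = ∑ a, numAsked hist a := by
  induction hist with
  | nil => simp [numAsked]
  | cons e l ih =>
    simp only [numAsked_cons, Finset.sum_add_distrib, List.length_cons, ih]
    simp

theorem IsNecessarilyRankMaximal.exists_mem (hM : IsNecessarilyRankMaximal hist M)
    (hc : Consistent p hist) (c : Choices n) (a : Fin n) : ∃ h, (a, h) ∈ M :=
  (hM.good hc : Good c p n M).covered (hM p hc).1 (.inl a)

/-- If an agent is never queried, then all other agents are queried to the end: the first choice
of that agent might be the house of any of them, and its last choice the house that it gets. -/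
theorem le_numAsked_of_not_asked (hn : 2 ≤ n) (hM : IsNecessarilyRankMaximal hist M)
    (hc : Consistent p hist) (c : Choices n) {a b : Fin n} (ha : numAsked hist a = 0)
    (hba : b ≠ a) : n - 1 ≤ numAsked hist b := by
  have hmat := (hM p hc).1
  obtain ⟨h, hah⟩ := hM.exists_mem hc c a
  obtain ⟨y, hby⟩ := hM.exists_mem hc c b
  have hyh : y ≠ h := by
    rintro rfl
    exact hba (hmat.agent_unique hby hah)
  have hpos : ∀ (q : Profile n) (x : Fin n), numAsked hist a < rank q a x := fun q x => by
    rw [ha]; exact one_le_rank q a x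
  obtain ⟨g, hg⟩ := exists_rank_eq p a le_rfl (by omega : 1 ≤ n)
  set p₁ := exchange p a g y with hp₁
  have hc₁ : Consistent p₁ hist := hc.exchange (hpos _ _) (hpos _ _)
  have hy₁ : rank p₁ a y = 1 := by rw [hp₁, rank_exchange_right, hg]
  obtain ⟨l, hl⟩ := exists_rank_eq p₁ a (by omega : 1 ≤ n) le_rfl
  set p₂ := exchange p₁ a h l with hp₂
  have hc₂ : Consistent p₂ hist := hc₁.exchange (hpos _ _) (hpos _ _)
  have hh₂ : rank p₂ a h = n := by rw [hp₂, rank_exchange_left, hl]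
  have hy₂ : rank p₂ a y = 1 := by
    rw [hp₂, rank_exchange_self, Equiv.swap_apply_of_ne_of_ne hyh, hy₁]
    rintro rfl
    omega
  have hG : Good c p₂ n M := hM.good hc₂
  have hun : ∀ j < n, ¬ Covered (upTo p₂ j M) (.inl a) := fun j hj =>
    (not_covered_upTo_of_lt hmat hah (by omega)).1
  obtain ⟨b', y', -, hb'M, hy', hb'⟩ := exists_same_first hG (hun 1 (by omega))
  obtain rfl : y' = y := rank_inj (hy'.trans hy₂.symm)
  obtain rfl : b' = b := hmat.agent_unique hb'M hby
  have hA : Alive c p₂ (n - 1) (.inl b') :=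
    (hG.alive_of_not_covered (by omega) (hun (n - 1) (by omega))).of_same_first hG (by omega) hy'
      hb'M hb'
  exact le_numAsked_of_unknown hM hc₂ hah (hpos _ _) hba (by omega) (by omega) (hA.mono (by omega))

theorem two_mul_totalQueries_le_of_not_asked (hn : 3 ≤ n) (hM : IsNecessarilyRankMaximal hist M)
    (hc : Consistent p hist) (c : Choices n) {a : Fin n} (ha : numAsked hist a = 0) :
    2 * totalQueries c p ≤ 3 * hist.length := by
  have h1 : totalQueries c p ≤ n * (n - 1) := by
    rw [totalQueries_eq_sum]
    refine (Finset.sum_le_card_nsmul _ _ _ fun b _ => queryCount_le b).trans_eq ?_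
    rw [Finset.card_univ, Fintype.card_fin, smul_eq_mul]
  have h2 : (n - 1) * (n - 1) ≤ hist.length := by
    rw [length_eq_sum_numAsked, ← Finset.sum_erase (Finset.univ) ha]
    refine le_trans ?_ (Finset.card_nsmul_le_sum _ _ (n - 1) fun b hb =>
      le_numAsked_of_not_asked (by omega) hM hc c ha (Finset.ne_of_mem_erase hb))
    rw [Finset.card_erase_of_mem (Finset.mem_univ a), Finset.card_univ, Fintype.card_fin,
      smul_eq_mul]
  obtain ⟨m, rfl⟩ : ∃ m, n = m + 1 := ⟨n - 1, by omega⟩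
  rw [Nat.add_sub_cancel] at h1 h2
  nlinarith

/-- If the house of `a` is unknown, then the other agents are queried as often as by the
elicitation algorithm. The loss at `a` is made up for by the gain at the agent that gets the first
choice of `a`, which the elicitation algorithm queries at least as often as `a`, and by the gain of
at least `1 / 2` at each of the other agents. -/
theorem two_mul_totalQueries_le_of_unknown (hn : 3 ≤ n) (hM : IsNecessarilyRankMaximal hist M)
    (hc : Consistent p hist) (c : Choices n) (hpos : ∀ b, 1 ≤ numAsked hist b) {a h : Fin n}
    (hah : (a, h) ∈ M) (hk : numAsked hist a < rank p a h) :
    2 * totalQueries c p ≤ 3 * hist.length := by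
  have hmat := (hM p hc).1
  have hG : Good c p n M := hM.good hc
  have hle : ∀ b, b ≠ a → queryCount c p b ≤ numAsked hist b := by
    intro b hb
    have h1 := one_le_queryCount (c := c) (p := p) (by omega) b
    obtain ⟨h2, h3⟩ := lt_queryCount_iff.1 (Nat.sub_lt h1 one_pos : queryCount c p b - 1 < _)
    exact le_numAsked_of_unknown hM hc hah hk hb h1 (by omega) h3
  have hpartner : queryCount c p a ≤ 1 ∨ ∃ b, b ≠ a ∧ queryCount c p a ≤ queryCount c p b := by
    by_cases h1 : queryCount c p a ≤ 1
    · exact Or.inl h1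
    obtain ⟨h2, h3⟩ := lt_queryCount_iff.1
      (Nat.sub_lt (by omega) one_pos : queryCount c p a - 1 < queryCount c p a)
    -- While `a` stays in `𝓔`, it is not covered, as its own pair completes a perfect matching.
    have hr : 1 < rank p a h := by
      by_contra hr
      obtain ⟨x, hx⟩ := ((hG.live_iff le_rfl (by omega)).1
        (h3 1 le_rfl (by omega))).exists_not_covered_house (hmat.subset upTo_subset)
      exact hx ((covered_of_unknown hM hc c hah hk x).mono (upTo_mono (by omega)))
    obtain ⟨b, y, hba, hbM, hay, hby⟩ :=
      exists_same_first hG (not_covered_upTo_of_lt hmat hah hr).1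
    have := lt_queryCount_iff.2 ⟨h2, h3.of_same_first hG (by omega) hay hbM hby⟩
    exact Or.inr ⟨b, hba, by omega⟩
  have hta := queryCount_le (c := c) (p := p) a
  rw [totalQueries_eq_sum, length_eq_sum_numAsked, Finset.mul_sum, Finset.mul_sum,
    ← Finset.add_sum_erase _ _ (Finset.mem_univ a),
    ← Finset.add_sum_erase _ (fun b => 3 * numAsked hist b) (Finset.mem_univ a)]
  have ha := hpos a
  rcases hpartner with h1 | ⟨b, hba, hab⟩
  · have : ∑ b ∈ Finset.univ.erase a, 2 * queryCount c p b ≤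
        ∑ b ∈ Finset.univ.erase a, 3 * numAsked hist b :=
      Finset.sum_le_sum fun b hb => by
        have := hle b (Finset.ne_of_mem_erase hb)
        omega
    omega
  · have hb : b ∈ Finset.univ.erase a := Finset.mem_erase.2 ⟨hba, Finset.mem_univ b⟩
    rw [← Finset.add_sum_erase _ _ hb, ← Finset.add_sum_erase _ (fun b => 3 * numAsked hist b) hb]
    have hsum : ∑ d ∈ (Finset.univ.erase a).erase b, (2 * queryCount c p d + 1) ≤
        ∑ d ∈ (Finset.univ.erase a).erase b, 3 * numAsked hist d :=
      Finset.sum_le_sum fun d hd => by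
        have := hle d (Finset.ne_of_mem_erase (Finset.mem_of_mem_erase hd))
        have := hpos d
        omega
    rw [Finset.sum_add_distrib, Finset.sum_const, Finset.card_erase_of_mem hb,
      Finset.card_erase_of_mem (Finset.mem_univ a), Finset.card_univ, Fintype.card_fin,
      smul_eq_mul, mul_one] at hsum
    have := hle b hba
    omega

/-- If the houses of all agents are known, then an agent is queried at most once more by the
elicitation algorithm, and this is a loss only for an agent `x` that is queried twice instead of
once. Such an agent gets its first choice, and it is accompanied by an agent with the same first
choice that has to be queried at least twice, which is a gain. -/
theorem two_mul_totalQueries_le_of_known (hn : 3 ≤ n) (hM : IsNecessarilyRankMaximal hist M)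
    (hc : Consistent p hist) (c : Choices n)
    (hknown : ∀ a h, (a, h) ∈ M → rank p a h ≤ numAsked hist a) :
    2 * totalQueries c p ≤ 3 * hist.length := by
  classical
  have hmat := (hM p hc).1
  have hG : Good c p n M := hM.good hc
  have hpos : ∀ a, 1 ≤ numAsked hist a := by
    intro a
    obtain ⟨h, hah⟩ := hM.exists_mem hc c a
    exact (one_le_rank p a h).trans (hknown a h hah)
  have hle : ∀ a, queryCount c p a - 1 ≤ numAsked hist a := by
    intro a
    obtain ⟨h, hah⟩ := hM.exists_mem hc c a
    rcases Nat.lt_or_ge 1 (queryCount c p a) with h1 | h1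
    · obtain ⟨h2, h3⟩ := lt_queryCount_iff.1
        (Nat.sub_lt (by omega) one_pos : queryCount c p a - 1 < queryCount c p a)
      exact le_numAsked_of_alive hM hc hah (hknown a h hah) (by omega) (by omega) h3
    · omega
  have hcomp : ∀ x, queryCount c p x = 2 ∧ numAsked hist x = 1 → ∃ y, queryCount c p y = 2 ∧
      2 ≤ numAsked hist y ∧ ∃ h, (x, h) ∈ M ∧ rank p y h = 1 := by
    rintro x ⟨hx2, hx1⟩
    obtain ⟨h, hxh⟩ := hM.exists_mem hc c x
    have hr : rank p x h = 1 := by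
      have := hknown x h hxh
      have := one_le_rank p x h
      omega
    have hA := (lt_queryCount_iff.1 (by omega : 1 < queryCount c p x)).2
    have hxup : (x, h) ∈ upTo p 1 M := mem_upTo.2 ⟨hxh, hr.le⟩
    have hmat1 : IsMatching (upTo p 1 M) := hmat.subset upTo_subset
    rcases (hG.live_iff le_rfl (by omega)).1 (hA 1 le_rfl le_rfl) with
      ⟨_, hcov⟩ | _ | ⟨v, _, hv, hvx⟩
    · exact absurd ⟨h, hxup⟩ hcov
    obtain rfl : Sum.inr h = v := hmat1.joined_unique (v := .inl x) hxup hvx.symm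
    rcases hv with _ | ⟨u, _, hu, huh⟩ | _
    rcases u with y | z
    swap
    · exact huh.elim
    obtain ⟨hyG, hyN⟩ := Finset.mem_sdiff.1 huh
    have hyr : rank p y h = 1 :=
      le_antisymm (rank_le_of_mem_irvingGraph hyG) (one_le_rank p y h)
    have hyA : Alive c p 1 (.inl y) := fun j h1 hj => by
      obtain rfl : j = 1 := by omega
      exact (hG.live_iff le_rfl (by omega)).2 hu
    have hy2 := lt_queryCount_iff.2 ⟨by omega, hyA⟩
    refine ⟨y, ?_, ?_, h, hxh, hyr⟩
    · by_contra hne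
      have hA2 := (lt_queryCount_iff.1 (by omega : 2 < queryCount c p y)).2
      have := le_numAsked_of_alive hM hc hxh (hknown x h hxh) (by omega) (by omega)
        (hA2.of_same_first hG (by omega) hyr hxh hr)
      omega
    · obtain ⟨z, hyz⟩ := hM.exists_mem hc c y
      have h1 := hknown y z hyz
      have h2 := one_le_rank p y z
      by_contra hlt
      have hz : rank p y z = rank p y h := by omega
      rw [rank_inj hz] at hyz
      exact hyN (mem_upTo.2 ⟨hyz, hyr.le⟩)
  choose! f hf using hcomp
  set L := Finset.univ.filter (fun x => queryCount c p x = 2 ∧ numAsked hist x = 1) with hL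
  have hinj : Set.InjOn f L := by
    intro x hx y hy hxy
    obtain ⟨-, -, g, hxg, hg⟩ := hf x (Finset.mem_filter.1 hx).2
    obtain ⟨-, -, h, hyh, hh⟩ := hf y (Finset.mem_filter.1 hy).2
    rw [hxy] at hg
    rw [rank_inj (hg.trans hh.symm)] at hxg
    exact hmat.agent_unique hxg hyh
  have hpoint : ∀ x, 2 * queryCount c p x + (if x ∈ L.image f then 1 else 0) ≤
      3 * numAsked hist x + (if x ∈ L then 1 else 0) := by
    intro x
    have h1 := hle x
    have h2 := hpos x
    by_cases hxL : x ∈ L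
    · obtain ⟨h3, h4⟩ := (Finset.mem_filter.1 hxL).2
      have : x ∉ L.image f := by
        intro hx
        obtain ⟨y, hy, rfl⟩ := Finset.mem_image.1 hx
        have := (hf y (Finset.mem_filter.1 hy).2).2.1
        omega
      rw [if_neg this, if_pos hxL]
      omega
    · rw [if_neg hxL]
      have h3 : ¬ (queryCount c p x = 2 ∧ numAsked hist x = 1) := fun h =>
        hxL (Finset.mem_filter.2 ⟨Finset.mem_univ x, h⟩)
      split_ifs with hx
      · obtain ⟨y, hy, rfl⟩ := Finset.mem_image.1 hx
        have := hf y (Finset.mem_filter.1 hy).2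
        omega
      · omega
  have hsum := Finset.sum_le_sum (s := Finset.univ) fun x _ => hpoint x
  simp only [Finset.sum_add_distrib, ← Finset.mul_sum, Finset.sum_boole, Finset.filter_univ_mem,
    Finset.card_image_of_injOn hinj, Nat.cast_id] at hsum
  rw [totalQueries_eq_sum, length_eq_sum_numAsked]
  omega

theorem two_mul_totalQueries_le (hn : 3 ≤ n) (hM : IsNecessarilyRankMaximal hist M)
    (hc : Consistent p hist) (c : Choices n) : 2 * totalQueries c p ≤ 3 * hist.length := by
  by_cases h0 : ∃ a, numAsked hist a = 0
  · obtain ⟨a, ha⟩ := h0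
    exact two_mul_totalQueries_le_of_not_asked hn hM hc c ha
  push Not at h0
  by_cases hk : ∃ a h, (a, h) ∈ M ∧ numAsked hist a < rank p a h
  · obtain ⟨a, h, hah, hk⟩ := hk
    exact two_mul_totalQueries_le_of_unknown hn hM hc c
      (fun b => Nat.one_le_iff_ne_zero.2 (h0 b)) hah hk
  push Not at hk
  exact two_mul_totalQueries_le_of_known hn hM hc c hk

/-- The minimum in the definition of `opt` is attained. -/
theorem exists_hist_of_opt (c : Choices n) (p : Profile n) : ∃ hist : History n,
    hist.length = opt p ∧ Consistent p hist ∧ ∃ M, IsNecessarilyRankMaximal hist M := by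
  obtain ⟨M, hist, hrun, hM⟩ := elicitsNRM c p
  exact Nat.sInf_mem (s := {q | ∃ hist : History n, hist.length = q ∧ Consistent p hist ∧
    ∃ M, IsNecessarilyRankMaximal hist M})
    ⟨_, hist, rfl, (Online.run_spec _ hrun).2 consistent_nil, M, hM⟩

/-- Without queries, it is possible that all agents have the same first choice, namely the house of
the first agent. As this house is not known to be its first choice, `covered_of_unknown` would imply
that the pairs of rank 1 cover all houses. -/
theorem not_isNecessarilyRankMaximal_nil (hn : 2 ≤ n) (c : Choices n) :
    ¬ IsNecessarilyRankMaximal [] M := by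
  intro hM
  obtain ⟨x, hx⟩ := hM.exists_mem (p := fun _ => Equiv.refl _) consistent_nil c ⟨0, by omega⟩
  obtain ⟨y, hy⟩ := hM.exists_mem (p := fun _ => Equiv.refl _) consistent_nil c ⟨1, by omega⟩
  have hmat := (hM (fun _ => Equiv.refl _) consistent_nil).1
  set p : Profile n := fun _ => Equiv.swap ⟨0, by omega⟩ x with hp
  have hrx : ∀ a, rank p a x = 1 := by
    intro a
    simp [rank, hp]
  have hcov := covered_of_unknown hM (p := p) consistent_nil c hx (by rw [hrx]; exact one_pos) y
  rw [hrx] at hcov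
  obtain ⟨b, hb⟩ := hcov
  obtain ⟨hbM, hbr⟩ := mem_upTo.1 hb
  have hyx : y = x := rank_inj (p := p) (a := b)
    ((le_antisymm hbr (one_le_rank p b y)).trans (hrx b).symm)
  have := hmat.agent_unique hx (hyx ▸ hy)
  simp at this

theorem isCompetitive (c : Choices n) : IsCompetitive (3 / 2) (elicitationAlgorithm n c) := by
  intro p
  obtain ⟨hist, hlen, hc, M, hM⟩ := exists_hist_of_opt c p
  by_cases hn : n = 2
  · subst hn
    refine ⟨_, _, run_elicitationAlgorithm_two c p, ?_⟩
    have : 1 ≤ opt p := by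
      rw [← hlen, Nat.one_le_iff_ne_zero]
      intro h0
      rw [List.eq_nil_of_length_eq_zero h0] at hM
      exact not_isNecessarilyRankMaximal_nil le_rfl c hM
    have : (1 : ℝ) ≤ opt p := by exact_mod_cast this
    rw [List.length_singleton]
    push_cast
    linarith
  · obtain ⟨hist', hrun, hlen'⟩ := run_elicitationAlgorithm hn c p
    refine ⟨_, hist', hrun, ?_⟩
    have : 2 * hist'.length ≤ 3 * opt p := by
      rw [hlen', ← hlen]
      rcases Nat.lt_or_ge n 3 with h3 | h3
      · have : totalQueries c p = 0 := by
          rw [totalQueries, show n - 1 = 0 by omega, Finset.sum_range_zero]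
        omega
      · exact two_mul_totalQueries_le h3 hM hc c
    have : (2 : ℝ) * hist'.length ≤ 3 * opt p := by exact_mod_cast this
    linarith

end Competitive

end HouseAllocation

theorem mainTheorem1 (n : ℕ) :
    Nonempty (HouseAllocation.Choices n) ∧
      ∀ c : HouseAllocation.Choices n,
        HouseAllocation.SimulatesIrving c ∧
        HouseAllocation.ElicitsNRM (HouseAllocation.elicitationAlgorithm n c) ∧
        HouseAllocation.IsCompetitive (3 / 2) (HouseAllocation.elicitationAlgorithm n c) :=
  ⟨HouseAllocation.nonempty_choices n, fun c => ⟨HouseAllocation.simulatesIrving c,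
    HouseAllocation.elicitsNRM c, HouseAllocation.isCompetitive c⟩⟩
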